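/- **Setting.** Let $G$ be a connected directed graph with finitely many vertices and edges $E_1,\dots,E_k$, without loops and with at most one edge between any two vertices. Some of the edges (leads) have only one vertex, which is then their initial vertex. A compact edge $E_i$ is identified with $(-r_i,r_i)$, $r_i>0$, the initial vertex corresponding to $-r_i$ and the terminal vertex to $r_i$; a lead is identified with $(-1,\infty)$, its vertex corresponding to $-1$, and we put $r_i=1$ for it. Let $V_i$ be real potentials with $V_i\in L^1(-r_i,r_i)$ on compact edges and, on leads, $V_i$ integrable near $-1$, locally integrable, and such that $-y''+V_iy=zy$ is in the limit point case at $\infty$. Throughout, $J=\begin{pmatrix}0&-I\\ I&0\end{pmatrix}$. For a vertex $v$ let $i_1<\dots<i_L$ be the edges with initial vertex $v$, $j_1<\dots<j_M$ those with terminal vertex $v$, and $n=n(v)=L+M$. Interface conditions are given by matrices $\beta(v)=(\beta_1\ \beta_2)\in\mathbb C^{n\times 2n}$, one for each $v$, with $\beta\beta^*=I$, $\beta J\beta^*=0$. A family of pairs of functions $(a_i,b_i)$ on the edges satisfies the conditions $\beta$ if at every vertex $$\beta_1\big(a_{i_1}(-r_{i_1}),\dots,a_{i_L}(-r_{i_L}),-a_{j_1}(r_{j_1}),\dots,-a_{j_M}(r_{j_M})\big)^t+\beta_2\big(b_{i_1}(-r_{i_1}),\dots,b_{i_L}(-r_{i_L}),b_{j_1}(r_{j_1}),\dots,b_{j_M}(r_{j_M})\big)^t=0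 .$$ The Schrödinger operator $S$ in $\mathcal H_1=\bigoplus_i L^2(E_i)$ has as domain all $f=(f_i)\in\mathcal H_1$ such that $f_i,f_i'$ are absolutely continuous (up to the vertices; locally on leads), $-f_i''+V_if_i\in L^2(E_i)$, and $(f_i',f_i)$ satisfies the conditions $\beta$; and $Sf=(-f_i''+V_if_i)$. A canonical system on $G$ consists of real $2\times2$ matrix functions $H_i\ge0$ on the edges, with $H_i\in L^1(-r_i,r_i)$ on compact edges and, on leads, $H_i$ locally integrable, integrable near $-1$, and $H_i\notin L^1(-1,\infty)$. Let $L^2_{H_i}(E_i)$ be the space of measurable $f:E_i\to\mathbb C^2$ with $\int f^*H_if<\infty$, modulo the functions with $\int f^*H_if=0$, and $\mathcal H_2=\bigoplus_iL^2_{H_i}(E_i)$. For interface conditions $\alpha$ (of the same kind as $\beta$), the relation $\mathcal S_{HG}\subset\mathcal H_2\oplus\mathcal H_2$ is the set of all $(f,g)$ such that each $f_{(i)}$ has an absolutely continuous (up to the vertices; locally on leads) representative $h_{(i)}$ with $Jh_{(i)}'=-H_ig_{(i)}$ a.e., and $(h_{(i)1},h_{(i)2})$ satisfies the conditions $\alpha$.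 **Theorem.** On every edge the solutions $p_i,q_i$ of $-y''+V_iy=0$ with $p_i'(-r_i)=1=q_i(-r_i)$, $q_i'(-r_i)=0=p_i(-r_i)$ exist. Put $$T_i=\begin{pmatrix}p_i'&q_i'\\ p_i&q_i\end{pmatrix},\qquad H_i=\begin{pmatrix}p_i^2&p_iq_i\\ p_iq_i&q_i^2\end{pmatrix}.$$ Then $T_i(x)\in SL(2,\mathbb R)$ at all points $x$ of the edge, its vertices included, and the $H_i$ form a canonical system on $G$. Let $N=\mathrm{diag}(-1,1)$, let $C\in\mathbb C^{2n\times2n}$ be the permutation matrix with $Ce_{2m-1}=e_m$, $Ce_{2m}=e_{n+m}$ ($1\le m\le n$), and for each vertex $v$ put $$\tilde\alpha(v)=\beta(v)\,C\Big(\bigoplus_{p=1}^LT_{i_p}(-r_{i_p})\oplus\bigoplus_{p=1}^MN\,T_{j_p}(r_{j_p})N\Big)C^* .$$ Then there are interface conditions $\alpha$, $\alpha\alpha^*=I$, $\alpha J\alpha^*=0$, with $\ker\alpha(v)=\ker\tilde\alpha(v)$ for all $v$. The formula $$U(f_i)=\left(T_i^{-1}\begin{pmatrix}0\\ f_i\end{pmatrix}\right)$$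 defines a unitary map $U:\mathcal H_1\to\mathcal H_2$ and, for every such $\alpha$, $$USU^*=\mathcal S_{HG},$$ where $S$ is identified with its graph and $\mathcal S_{HG}$ is the relation of the canonical system $(H_i)$ with the interface conditions $\alpha$. -/

import Mathlib

open MeasureTheory Set
open scoped Matrix ComplexConjugate

/-! ### Hamiltonians of order two and the spaces `L²_H` -/

/-- The coefficient function of a canonical system `J u' = -z H u` of order two on an interval `I`:
`H (x)` is a real symmetric positive semidefinite `2 × 2` matrix for almost every `x ∈ I`, and `H`
is locally integrable on `I` (entry by entry). The values of `H` outside `I` are irrelevant. -/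
structure Hamiltonian (I : Set ℝ) where
  toFun : ℝ → Matrix (Fin 2) (Fin 2) ℝ
  posSemidef : ∀ᵐ x ∂(volume.restrict I), (toFun x).PosSemidef
  locallyIntegrable : ∀ a b, LocallyIntegrableOn (fun x => toFun x a b) I

namespace Hamiltonian

variable {I : Set ℝ} (H : Hamiltonian I)

/-- `H (x)` as a complex matrix. -/
def cplx (x : ℝ) : Matrix (Fin 2) (Fin 2) ℂ := (H.toFun x).map (fun t : ℝ => (t : ℂ))

/-- The integrand `f(x)* H(x) g(x)`. -/
def form (f g : ℝ → Fin 2 → ℂ) (x : ℝ) : ℂ := star (f x) ⬝ᵥ (H.cplx x *ᵥ g x)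

theorem exists_factor : ∀ᵐ x ∂(volume.restrict I),
    ∃ B : Matrix (Fin 2) (Fin 2) ℂ, H.cplx x = Bᴴ * B := by
  filter_upwards [H.posSemidef] with x hx
  obtain ⟨B, hB⟩ : ∃ B : Matrix (Fin 2) (Fin 2) ℝ, H.toFun x = Bᴴ * B := by
    open scoped MatrixOrder in
    exact CStarAlgebra.nonneg_iff_eq_star_mul_self.mp hx.nonneg
  refine ⟨B.map (fun t : ℝ => (t : ℂ)), ?_⟩
  ext i j
  simp [cplx, hB, Matrix.mul_apply]

theorem form_factor {B : Matrix (Fin 2) (Fin 2) ℂ} {x : ℝ} (hB : H.cplx x = Bᴴ * B)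
    (f g : ℝ → Fin 2 → ℂ) : H.form f g x = star (B *ᵥ f x) ⬝ᵥ (B *ᵥ g x) := by
  rw [form, hB, ← Matrix.mulVec_mulVec, Matrix.dotProduct_mulVec, Matrix.star_mulVec]

theorem form_self_eq {B : Matrix (Fin 2) (Fin 2) ℂ} {x : ℝ} (hB : H.cplx x = Bᴴ * B)
    (f : ℝ → Fin 2 → ℂ) :
    H.form f f x = ((‖(B *ᵥ f x) 0‖ ^ 2 + ‖(B *ᵥ f x) 1‖ ^ 2 : ℝ) : ℂ) := by
  rw [H.form_factor hB]
  simp only [dotProduct, Fin.sum_univ_two, Pi.star_apply, RCLike.star_def, Complex.conj_mul']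
  push_cast
  ring

theorem norm_form_le : ∀ᵐ x ∂(volume.restrict I), ∀ f g : ℝ → Fin 2 → ℂ,
    ‖H.form f g x‖ ≤ ‖H.form f f x‖ + ‖H.form g g x‖ := by
  filter_upwards [H.exists_factor] with x hx f g
  obtain ⟨B, hB⟩ := hx
  rw [H.form_self_eq hB f, H.form_self_eq hB g, H.form_factor hB, Complex.norm_real,
    Complex.norm_real, Real.norm_of_nonneg (by positivity), Real.norm_of_nonneg (by positivity)]
  simp only [dotProduct, Fin.sum_univ_two, Pi.star_apply, RCLike.star_def]
  refine (norm_add_le _ _).trans ?_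
  simp only [norm_mul, RCLike.norm_conj]
  nlinarith [sq_nonneg (‖(B *ᵥ f x) 0‖ - ‖(B *ᵥ g x) 0‖),
    sq_nonneg (‖(B *ᵥ f x) 1‖ - ‖(B *ᵥ g x) 1‖), sq_nonneg ‖(B *ᵥ f x) 0‖,
    sq_nonneg ‖(B *ᵥ f x) 1‖, sq_nonneg ‖(B *ᵥ g x) 0‖, sq_nonneg ‖(B *ᵥ g x) 1‖]

theorem form_add_left (f g h : ℝ → Fin 2 → ℂ) (x : ℝ) :
    H.form (f + g) h x = H.form f h x + H.form g h x := by
  simp [form, add_dotProduct]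

theorem form_add_right (f g h : ℝ → Fin 2 → ℂ) (x : ℝ) :
    H.form f (g + h) x = H.form f g x + H.form f h x := by
  rw [form, form, form, Pi.add_apply, Matrix.mulVec_add, dotProduct_add]

theorem form_smul_left (c : ℂ) (f g : ℝ → Fin 2 → ℂ) (x : ℝ) :
    H.form (c • f) g x = conj c * H.form f g x := by
  simp [form, smul_dotProduct]

theorem form_smul_right (c : ℂ) (f g : ℝ → Fin 2 → ℂ) (x : ℝ) :
    H.form f (c • g) x = c * H.form f g x := by
  rw [form, form, Pi.smul_apply, Matrix.mulVec_smul, dotProduct_smul, smul_eq_mul]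

theorem form_conj_symm : ∀ᵐ x ∂(volume.restrict I), ∀ f g : ℝ → Fin 2 → ℂ,
    conj (H.form g f x) = H.form f g x := by
  filter_upwards [H.exists_factor] with x hx f g
  obtain ⟨B, hB⟩ := hx
  rw [H.form_factor hB, H.form_factor hB]
  simp [dotProduct, Fin.sum_univ_two, mul_comm]

theorem aestronglyMeasurable_form {f g : ℝ → Fin 2 → ℂ}
    (hf : AEStronglyMeasurable f (volume.restrict I))
    (hg : AEStronglyMeasurable g (volume.restrict I)) :
    AEStronglyMeasurable (H.form f g) (volume.restrict I) := by
  have hH : ∀ a b, AEStronglyMeasurable (fun x => ((H.toFun x a b : ℝ) : ℂ))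
      (volume.restrict I) := fun a b =>
    Complex.continuous_ofReal.comp_aestronglyMeasurable
      (H.locallyIntegrable a b).aestronglyMeasurable
  have hf' : ∀ a, AEStronglyMeasurable (fun x => conj (f x a)) (volume.restrict I) := fun a =>
    Complex.continuous_conj.comp_aestronglyMeasurable
      ((continuous_apply a).comp_aestronglyMeasurable hf)
  have hg' : ∀ a, AEStronglyMeasurable (fun x => g x a) (volume.restrict I) := fun a =>
    (continuous_apply a).comp_aestronglyMeasurable hg
  have : H.form f g = fun x =>
      conj (f x 0) * (((H.toFun x 0 0 : ℝ) : ℂ) * g x 0 + ((H.toFun x 0 1 : ℝ) : ℂ) * g x 1) +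
      conj (f x 1) * (((H.toFun x 1 0 : ℝ) : ℂ) * g x 0 + ((H.toFun x 1 1 : ℝ) : ℂ) * g x 1) := by
    funext x
    simp [form, cplx, dotProduct, Matrix.mulVec, Fin.sum_univ_two]
  rw [this]
  exact ((hf' 0).mul (((hH 0 0).mul (hg' 0)).add ((hH 0 1).mul (hg' 1)))).add
    ((hf' 1).mul (((hH 1 0).mul (hg' 0)).add ((hH 1 1).mul (hg' 1))))

theorem integrable_form {f g : ℝ → Fin 2 → ℂ}
    (hf : AEStronglyMeasurable f (volume.restrict I) ∧ IntegrableOn (H.form f f) I)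
    (hg : AEStronglyMeasurable g (volume.restrict I) ∧ IntegrableOn (H.form g g) I) :
    IntegrableOn (H.form f g) I := by
  refine Integrable.mono' (hf.2.norm.add hg.2.norm) (H.aestronglyMeasurable_form hf.1 hg.1) ?_
  filter_upwards [H.norm_form_le] with x hx
  exact hx f g

/-- The space `V` of all measurable `f : I → ℂ²` with `∫_I f* H f < ∞`. -/
def preSubmodule : Submodule ℂ (ℝ → Fin 2 → ℂ) where
  carrier := {f | AEStronglyMeasurable f (volume.restrict I) ∧ IntegrableOn (H.form f f) I}
  zero_mem' := by
    refine ⟨aestronglyMeasurable_zero, ?_⟩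
    have : H.form 0 0 = 0 := by
      funext x
      simp [form]
    rw [this]
    exact integrableOn_zero
  add_mem' := by
    intro f g hf hg
    refine ⟨hf.1.add hg.1, ?_⟩
    have : H.form (f + g) (f + g) =
        (H.form f f + H.form f g) + (H.form g f + H.form g g) := by
      funext x
      simp [form_add_left, form_add_right]
      ring
    rw [this]
    exact (hf.2.add (H.integrable_form hf hg)).add ((H.integrable_form hg hf).add hg.2)
  smul_mem' := by
    intro c f hf
    refine ⟨hf.1.const_smul c, ?_⟩
    have : H.form (c • f) (c • f) = fun x => conj c * (c * H.form f f x) := by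
      funext x
      simp [form_smul_left, form_smul_right]
      ring
    rw [this]
    exact (hf.2.const_mul c).const_mul (conj c)

/-- The space `V` as a type of its own, to carry the seminorm `(∫_I f* H f)^(1/2)`. -/
def PreL2 : Type := H.preSubmodule

noncomputable instance : AddCommGroup H.PreL2 := inferInstanceAs (AddCommGroup H.preSubmodule)

noncomputable instance : Module ℂ H.PreL2 := inferInstanceAs (Module ℂ H.preSubmodule)

/-- The underlying function of an element of `V`. -/
def PreL2.fn {H : Hamiltonian I} (f : H.PreL2) : ℝ → Fin 2 → ℂ := f.1

/-- The semi-inner product `⟨f, g⟩ = ∫_I f* H g` on `V`. -/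
@[reducible] noncomputable def core : PreInnerProductSpace.Core ℂ H.PreL2 where
  inner f g := ∫ x in I, H.form f.fn g.fn x
  conj_inner_symm f g := by
    rw [← integral_conj]
    refine integral_congr_ae ?_
    filter_upwards [H.form_conj_symm] with x hx
    exact hx _ _
  re_inner_nonneg f := by
    have hf : Integrable (H.form f.fn f.fn) (volume.restrict I) := f.2.2
    rw [← integral_re hf]
    refine integral_nonneg_of_ae ?_
    filter_upwards [H.exists_factor] with x hx
    obtain ⟨B, hB⟩ := hx
    have h := H.form_self_eq hB f.fn
    simp only [h, Pi.zero_apply, RCLike.re_to_complex, Complex.ofReal_re]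
    positivity
  add_left f g h := by
    have h1 : Integrable (H.form f.fn h.fn) (volume.restrict I) := H.integrable_form f.2 h.2
    have h2 : Integrable (H.form g.fn h.fn) (volume.restrict I) := H.integrable_form g.2 h.2
    rw [← integral_add h1 h2]
    exact integral_congr_ae (Filter.Eventually.of_forall fun x => H.form_add_left _ _ _ x)
  smul_left f g c := by
    rw [← integral_const_mul]
    exact integral_congr_ae (Filter.Eventually.of_forall fun x => H.form_smul_left _ _ _ x)

noncomputable instance : SeminormedAddCommGroup H.PreL2 :=
  InnerProductSpace.Core.toSeminormedAddCommGroup (c := H.core)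

noncomputable instance : InnerProductSpace ℂ H.PreL2 := InnerProductSpace.ofCore H.core

/-- `L²_H (I) = V / N`, where `N` is the null space of the seminorm. -/
abbrev L2 : Type := SeparationQuotient H.PreL2

/-- The element of `L²_H (I)` represented by `f`. -/
noncomputable def cls {H : Hamiltonian I} (f : H.PreL2) : H.L2 := SeparationQuotient.mk f

end Hamiltonian

/-! ### Graphs -/

/-- A connected directed metric graph with vertex set `V` and edge set `E`. The edge `e` starts at
`src e`. If `tgt e = some v`, it is a compact edge that ends at `v` and is parametrised by
`(-r e, r e)`; if `tgt e = none`, it is a lead, parametrised by `(-1, ∞)`, and then `r e = 1`.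
There are no loops and at most one edge between any two vertices. -/
structure MetricGraph (V E : Type*) where
  src : E → V
  tgt : E → Option V
  r : E → ℝ
  r_pos : ∀ e, 0 < r e
  r_lead : ∀ e, tgt e = none → r e = 1
  no_loop : ∀ e, tgt e ≠ some (src e)
  simple : ∀ e e' v v', tgt e = some v → tgt e' = some v' →
    s(src e, v) = s(src e', v') → e = e'
  connected : (SimpleGraph.fromRel fun u v => ∃ e, src e = u ∧ tgt e = some v).Connected

namespace MetricGraph

variable {V E : Type*} (G : MetricGraph V E)

/-- The open interval of the edge `e`: `(-r e, r e)` for a compact edge, `(-1, ∞)` for a lead. -/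
def edge (e : E) : Set ℝ := {x | -G.r e < x ∧ (G.tgt e ≠ none → x < G.r e)}

/-- The edge with its vertices: `[-r e, r e]` for a compact edge, `[-1, ∞)` for a lead. -/
def closedEdge (e : E) : Set ℝ := {x | -G.r e ≤ x ∧ (G.tgt e ≠ none → x ≤ G.r e)}

/-- Integrability up to the vertices: `h ∈ L¹(-r e, r e)` on a compact edge; on a lead, `h` is
integrable on `(-1, c)` for all `c > -1`. -/
def IntegrableUpToVertices (e : E) (h : ℝ → ℝ) : Prop :=
  ∀ c ∈ G.closedEdge e, IntegrableOn h (Ioo (-G.r e) c)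

/-- Absolute continuity on `[-r e, r e]` for a compact edge, and on `[-1, c]` for all `c > -1`
for a lead. -/
def AC {F : Type*} [SeminormedAddCommGroup F] (e : E) (f : ℝ → F) : Prop :=
  ∀ c ∈ G.closedEdge e, AbsolutelyContinuousOnInterval f (-G.r e) c

/-- The edge ends at the vertex `v`: outgoing edges (`E_o(v)`), then incoming ones (`E_t(v)`). -/
abbrev End (v : V) : Type _ := {e : E // G.src e = v} ⊕ {e : E // G.tgt e = some v}

/-- The vector of boundary values at `v`: for outgoing edges `a (-r e)`, `b (-r e)`,
for incoming edges `-a (r e)`, `b (r e)`, with all the `a` values first. -/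
def boundary (v : V) (a b : E → ℝ → ℂ) : G.End v ⊕ G.End v → ℂ :=
  Sum.elim
    (Sum.elim (fun e => a e.1 (-G.r e.1)) (fun e => -a e.1 (G.r e.1)))
    (Sum.elim (fun e => b e.1 (-G.r e.1)) (fun e => b e.1 (G.r e.1)))

theorem boundary_zero (v : V) : G.boundary v 0 0 = 0 := by
  funext i
  rcases i with (i | i) | (i | i) <;> simp [boundary]

theorem boundary_add (v : V) (a b a' b' : E → ℝ → ℂ) :
    G.boundary v (a + a') (b + b') = G.boundary v a b + G.boundary v a' b' := by
  funext i
  rcases i with (i | i) | (i | i) <;> simp [boundary, add_comm]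

theorem boundary_smul (v : V) (c : ℂ) (a b : E → ℝ → ℂ) :
    G.boundary v (c • a) (c • b) = c • G.boundary v a b := by
  funext i
  rcases i with (i | i) | (i | i) <;> simp [boundary]

variable {G} in
theorem AC.zero {F : Type*} [SeminormedAddCommGroup F] (e : E) : G.AC e (0 : ℝ → F) := by
  intro c _
  have h : LipschitzOnWith 0 (0 : ℝ → F) (uIcc (-G.r e) c) := by
    intro x _ y _
    simp
  exact h.absolutelyContinuousOnInterval

theorem ae_mem_edge (e : E) : ∀ᵐ x ∂(volume.restrict (G.edge e)), x ∈ G.edge e := by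
  refine ae_restrict_mem ?_
  have h : G.edge e = Ioi (-G.r e) ∩ {x | G.tgt e ≠ none → x < G.r e} := rfl
  rw [h]
  refine measurableSet_Ioi.inter ?_
  by_cases ht : G.tgt e = none
  · simp [ht]
  · simp only [ne_eq, ht, not_false_eq_true, forall_true_left]
    exact measurableSet_Iio

theorem isOpen_edge (e : E) : IsOpen (G.edge e) := by
  have h : G.edge e = Ioi (-G.r e) ∩ {x | G.tgt e ≠ none → x < G.r e} := rfl
  rw [h]
  refine isOpen_Ioi.inter ?_
  by_cases ht : G.tgt e = none
  · simp [ht]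
  · simp only [ne_eq, ht, not_false_eq_true, forall_true_left]
    exact isOpen_Iio

/-- `y` solves `-y'' + W y = g` on the edge `e`, and its derivative is `y'`. Both `y` and `y'` are
absolutely continuous up to the vertices. -/
structure Solves {F : Type*} [NormedAddCommGroup F] [NormedSpace ℝ F] (e : E) (W : ℝ → ℝ)
    (y y' g : ℝ → F) : Prop where
  ac : G.AC e y
  ac' : G.AC e y'
  hasDerivAt : ∀ x ∈ G.edge e, HasDerivAt y (y' x) x
  eqn : ∀ᵐ x ∂(volume.restrict (G.edge e)), ∃ d, HasDerivAt y' d x ∧ -d + W x • y x = g x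

/-- The equation `-y'' + W y = z y` on a lead is in the limit point case at infinity: for some
`z ∈ ℂ`, not all of its solutions are square integrable. -/
def LimitPoint (e : E) (W : ℝ → ℝ) : Prop :=
  ∃ (z : ℂ) (y y' : ℝ → ℂ), G.Solves e W y y' (z • y) ∧
    ¬ MemLp y 2 (volume.restrict (G.edge e))

/-- Potentials on the edges: integrable on compact edges; on leads, integrable near `-1`, locally
integrable, and in the limit point case at infinity. -/
structure Potential where
  fn : E → ℝ → ℝ
  integrable : ∀ e, G.IntegrableUpToVertices e (fn e)
  limitPoint : ∀ e, G.tgt e = none → G.LimitPoint e (fn e)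

variable [DecidableEq V] [Fintype E] [DecidableEq E]

/-- Interface conditions: at each vertex `v` with `n` edge ends, an `n × 2n` matrix `β` with
`β β* = 1` and `β J β* = 0`. -/
structure InterfaceConditions where
  mat : ∀ v, Matrix (G.End v) (G.End v ⊕ G.End v) ℂ
  mul_conjTranspose : ∀ v, mat v * (mat v)ᴴ = 1
  mul_J_mul : ∀ v, mat v * Matrix.J (G.End v) ℂ * (mat v)ᴴ = 0

variable {G}

/-! ### The Schrödinger operator -/

/-- `⊕ₑ L²(e)`. -/
abbrev SpaceL2 (G : MetricGraph V E) : Type _ :=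
  PiLp 2 fun e : E => Lp ℂ 2 (volume.restrict (G.edge e))

/-- The graph of the Schrödinger operator: all `(f, g)` in `⊕ₑ L²(e)` such that `f` has a
representative `y` with `y`, `y'` absolutely continuous, `g = -y'' + V y`, and `y` satisfies the
interface conditions. -/
def schrodingerGraph (P : G.Potential) (β : G.InterfaceConditions) :
    Submodule ℂ (G.SpaceL2 × G.SpaceL2) where
  carrier := {fg | ∃ y y' : E → ℝ → ℂ,
    (∀ e, fg.1 e =ᵐ[volume.restrict (G.edge e)] y e) ∧
    (∀ e, G.Solves e (P.fn e) (y e) (y' e) (fg.2 e)) ∧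
    ∀ v, β.mat v *ᵥ G.boundary v y' y = 0}
  zero_mem' := by
    refine ⟨0, 0, fun e => Lp.coeFn_zero _ _ _, fun e => ⟨AC.zero e, AC.zero e, ?_, ?_⟩, ?_⟩
    · intro x _
      exact hasDerivAt_const x (0 : ℂ)
    · filter_upwards [Lp.coeFn_zero ℂ 2 (volume.restrict (G.edge e))] with x hx
      refine ⟨0, hasDerivAt_const x (0 : ℂ), ?_⟩
      have : (((0 : G.SpaceL2 × G.SpaceL2).2 e : Lp ℂ 2 (volume.restrict (G.edge e))) : ℝ → ℂ) x
        = 0 := hx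
      rw [this]
      simp
    · intro v
      rw [G.boundary_zero v, Matrix.mulVec_zero]
  add_mem' := by
    rintro ⟨f, g⟩ ⟨f₁, g₁⟩ ⟨y, y', hy, hs, hb⟩ ⟨w, w', hw, hs₁, hb₁⟩
    refine ⟨y + w, y' + w', fun e => ?_, fun e => ⟨?_, ?_, ?_, ?_⟩, fun v => ?_⟩
    · filter_upwards [hy e, hw e, Lp.coeFn_add (f e) (f₁ e)] with x h1 h2 h3
      exact h3.trans (by simp_all)
    · exact fun c hc => ((hs e).ac c hc).add ((hs₁ e).ac c hc)
    · exact fun c hc => ((hs e).ac' c hc).add ((hs₁ e).ac' c hc)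
    · exact fun x hx => ((hs e).hasDerivAt x hx).add ((hs₁ e).hasDerivAt x hx)
    · filter_upwards [(hs e).eqn, (hs₁ e).eqn, Lp.coeFn_add (g e) (g₁ e)] with x h1 h2 h3
      obtain ⟨d, hd, h1⟩ := h1
      obtain ⟨d₁, hd₁, h2⟩ := h2
      refine ⟨d + d₁, hd.add hd₁, Eq.trans ?_ h3.symm⟩
      simp only [Pi.add_apply, smul_add] at h1 h2 ⊢
      rw [← h1, ← h2]
      ring
    · rw [G.boundary_add, Matrix.mulVec_add, hb, hb₁, add_zero]
  smul_mem' := by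
    rintro c ⟨f, g⟩ ⟨y, y', hy, hs, hb⟩
    refine ⟨c • y, c • y', fun e => ?_, fun e => ⟨?_, ?_, ?_, ?_⟩, fun v => ?_⟩
    · filter_upwards [hy e, Lp.coeFn_smul c (f e)] with x h1 h3
      exact h3.trans (by simp_all)
    · exact fun b hb => ((hs e).ac b hb).const_smul c
    · exact fun b hb => ((hs e).ac' b hb).const_smul c
    · exact fun x hx => ((hs e).hasDerivAt x hx).const_smul c
    · filter_upwards [(hs e).eqn, Lp.coeFn_smul c (g e)] with x h1 h3
      obtain ⟨d, hd, h1⟩ := h1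
      refine ⟨c • d, hd.const_smul c, Eq.trans ?_ h3.symm⟩
      simp only [Pi.smul_apply, smul_eq_mul, Complex.real_smul] at h1 ⊢
      rw [← h1]
      ring
    · rw [G.boundary_smul, Matrix.mulVec_smul, hb, smul_zero]

theorem schrodingerGraph_single_valued (P : G.Potential) (β : G.InterfaceConditions)
    (fg : G.SpaceL2 × G.SpaceL2) (h : fg ∈ schrodingerGraph P β) (h0 : fg.1 = 0) : fg.2 = 0 := by
  obtain ⟨f, g⟩ := fg
  obtain ⟨y, y', hy, hs, -⟩ := h
  simp only at h0
  subst h0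
  ext e : 1
  have hy0 : ∀ x ∈ G.edge e, y e x = 0 := by
    have hae : y e =ᵐ[volume.restrict (G.edge e)] 0 :=
      (hy e).symm.trans (Lp.coeFn_zero ℂ 2 (volume.restrict (G.edge e)))
    exact Measure.eqOn_open_of_ae_eq hae (G.isOpen_edge e)
      (fun x hx => ((hs e).hasDerivAt x hx).continuousAt.continuousWithinAt)
      continuousOn_const
  have hev : ∀ x ∈ G.edge e, y e =ᶠ[nhds x] fun _ => 0 := fun x hx =>
    Filter.eventually_of_mem ((G.isOpen_edge e).mem_nhds hx) hy0
  have hy'0 : ∀ x ∈ G.edge e, y' e x = 0 := fun x hx =>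
    ((hs e).hasDerivAt x hx).unique ((hasDerivAt_const x (0 : ℂ)).congr_of_eventuallyEq (hev x hx))
  have hev' : ∀ x ∈ G.edge e, y' e =ᶠ[nhds x] fun _ => 0 := fun x hx =>
    Filter.eventually_of_mem ((G.isOpen_edge e).mem_nhds hx) hy'0
  refine Lp.ext ?_
  filter_upwards [(hs e).eqn, G.ae_mem_edge e,
    Lp.coeFn_zero ℂ 2 (volume.restrict (G.edge e))] with x hx hxe h0
  obtain ⟨d, hd, hx⟩ := hx
  have hd0 : d = 0 :=
    hd.unique ((hasDerivAt_const x (0 : ℂ)).congr_of_eventuallyEq (hev' x hxe))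
  refine Eq.trans ?_ h0.symm
  rw [hd0, hy0 x hxe] at hx
  simpa using hx.symm

/-- The Schrödinger operator `S` on the graph, as an unbounded linear operator. -/
noncomputable def schrodinger (P : G.Potential) (β : G.InterfaceConditions) :
    G.SpaceL2 →ₗ.[ℂ] G.SpaceL2 := (schrodingerGraph P β).toLinearPMap

theorem schrodinger_graph (P : G.Potential) (β : G.InterfaceConditions) :
    (schrodinger P β).graph = schrodingerGraph P β :=
  Submodule.toLinearPMap_graph_eq _ (fun x hx hx' => schrodingerGraph_single_valued P β x hx hx')

/-! ### Canonical systems on a graph -/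

/-- Canonical systems on the edges of `G`: `H ∈ L¹(-r e, r e)` on a compact edge; on a lead,
the endpoint `-1` is regular and `H ∉ L¹(-1, ∞)`. -/
structure CanonicalSystem {V E : Type*} (G : MetricGraph V E) where
  H : ∀ e, Hamiltonian (G.edge e)
  regular : ∀ e a b, G.IntegrableUpToVertices e fun x => (H e).toFun x a b
  not_integrable : ∀ e, G.tgt e = none →
    ¬ ∀ a b, IntegrableOn (fun x => (H e).toFun x a b) (G.edge e)

/-- `⊕ₑ L²_{Hₑ}(e)`. -/
abbrev CanonicalSystem.Space {G : MetricGraph V E} (K : G.CanonicalSystem) : Type _ :=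
  PiLp 2 fun e : E => (K.H e).L2

/-- The relation of the canonical system `H` on the graph with interface conditions `α`: all
`(f, g)` such that `f` has an absolutely continuous representative `h` which satisfies
`J h' = -H g` almost everywhere and the interface conditions. -/
noncomputable def CanonicalSystem.relation (K : G.CanonicalSystem) (α : G.InterfaceConditions) :
    Submodule ℂ (K.Space × K.Space) where
  carrier := {fg | ∃ h k : ∀ e, (K.H e).PreL2,
    (∀ e, fg.1 e = Hamiltonian.cls (h e)) ∧
    (∀ e, fg.2 e = Hamiltonian.cls (k e)) ∧
    (∀ e, G.AC e (h e).fn) ∧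
    (∀ e, ∀ᵐ x ∂(volume.restrict (G.edge e)), ∃ d, HasDerivAt (h e).fn d x ∧
      !![0, -1; 1, 0] *ᵥ d = -((K.H e).cplx x *ᵥ (k e).fn x)) ∧
    ∀ v, α.mat v *ᵥ G.boundary v (fun e x => (h e).fn x 0) (fun e x => (h e).fn x 1) = 0}
  zero_mem' := by
    refine ⟨0, 0, fun e => rfl, fun e => rfl, fun e => AC.zero e, fun e => ?_, fun v => ?_⟩
    · refine Filter.Eventually.of_forall fun x => ⟨0, hasDerivAt_const x (0 : Fin 2 → ℂ), ?_⟩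
      have : ((0 : ∀ e, (K.H e).PreL2) e).fn x = 0 := rfl
      rw [this, Matrix.mulVec_zero, Matrix.mulVec_zero, neg_zero]
    · have : G.boundary v (fun e x => ((0 : ∀ e, (K.H e).PreL2) e).fn x 0)
        (fun e x => ((0 : ∀ e, (K.H e).PreL2) e).fn x 1) = 0 := G.boundary_zero v
      rw [this, Matrix.mulVec_zero]
  add_mem' := by
    rintro ⟨f, g⟩ ⟨f₁, g₁⟩ ⟨h, k, hf, hg, hac, heq, hb⟩ ⟨h₁, k₁, hf₁, hg₁, hac₁, heq₁, hb₁⟩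
    refine ⟨h + h₁, k + k₁, fun e => ?_, fun e => ?_,
      fun e c hc => (hac e c hc).add (hac₁ e c hc), fun e => ?_, fun v => ?_⟩
    · change f e + f₁ e = _
      rw [show f e = _ from hf e, show f₁ e = _ from hf₁ e]
      rfl
    · change g e + g₁ e = _
      rw [show g e = _ from hg e, show g₁ e = _ from hg₁ e]
      rfl
    · filter_upwards [heq e, heq₁ e] with x hx hx₁
      obtain ⟨d, hd, hx⟩ := hx
      obtain ⟨d₁, hd₁, hx₁⟩ := hx₁
      refine ⟨d + d₁, hd.add hd₁, ?_⟩
      have : ((k + k₁) e).fn x = (k e).fn x + (k₁ e).fn x := rfl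
      rw [this, Matrix.mulVec_add, Matrix.mulVec_add, hx, hx₁, neg_add]
    · have : G.boundary v (fun e x => ((h + h₁) e).fn x 0) (fun e x => ((h + h₁) e).fn x 1) =
        _ + _ := G.boundary_add v (fun e x => (h e).fn x 0) (fun e x => (h e).fn x 1)
          (fun e x => (h₁ e).fn x 0) (fun e x => (h₁ e).fn x 1)
      rw [this, Matrix.mulVec_add, hb, hb₁, add_zero]
  smul_mem' := by
    rintro c ⟨f, g⟩ ⟨h, k, hf, hg, hac, heq, hb⟩
    refine ⟨c • h, c • k, fun e => ?_, fun e => ?_,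
      fun e b hb => (hac e b hb).const_smul c, fun e => ?_, fun v => ?_⟩
    · change c • f e = _
      rw [show f e = _ from hf e]
      rfl
    · change c • g e = _
      rw [show g e = _ from hg e]
      rfl
    · filter_upwards [heq e] with x hx
      obtain ⟨d, hd, hx⟩ := hx
      refine ⟨c • d, hd.const_smul c, ?_⟩
      have : ((c • k) e).fn x = c • (k e).fn x := rfl
      rw [this, Matrix.mulVec_smul, Matrix.mulVec_smul, hx, smul_neg]
    · have : G.boundary v (fun e x => ((c • h) e).fn x 0) (fun e x => ((c • h) e).fn x 1) =
        _ • _ := G.boundary_smul v c (fun e x => (h e).fn x 0) (fun e x => (h e).fn x 1)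
      rw [this, Matrix.mulVec_smul, hb, smul_zero]

/-! ### The transformation -/

/-- The solutions `p`, `q` of `-y'' + V y = 0` on each edge, with derivatives `p'`, `q'`,
normalised by `p'(-r) = 1 = q(-r)` and `q'(-r) = 0 = p(-r)`. -/
structure FundamentalSystem {V E : Type*} {G : MetricGraph V E} (P : G.Potential) where
  p : E → ℝ → ℝ
  p' : E → ℝ → ℝ
  q : E → ℝ → ℝ
  q' : E → ℝ → ℝ
  solves_p : ∀ e, G.Solves e (P.fn e) (p e) (p' e) 0
  solves_q : ∀ e, G.Solves e (P.fn e) (q e) (q' e) 0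
  p'_init : ∀ e, p' e (-G.r e) = 1
  p_init : ∀ e, p e (-G.r e) = 0
  q'_init : ∀ e, q' e (-G.r e) = 0
  q_init : ∀ e, q e (-G.r e) = 1

namespace FundamentalSystem

variable {P : G.Potential} (F : FundamentalSystem P)

/-- The transfer matrix `T`. -/
def T (e : E) (x : ℝ) : Matrix (Fin 2) (Fin 2) ℝ :=
  !![F.p' e x, F.q' e x; F.p e x, F.q e x]

/-- The matrices which act on the boundary values at the edge ends at `v`: `T(-r)` at an outgoing
end; `N T(r) N` with `N = diag(-1, 1)` at an incoming end, where the first components enter the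
interface condition with a minus sign. -/
def endMatrix (v : V) : G.End v → Matrix (Fin 2) (Fin 2) ℂ :=
  Sum.elim
    (fun e => (F.T e.1 (-G.r e.1)).map (fun t : ℝ => (t : ℂ)))
    (fun e => (!![-1, 0; 0, 1] * F.T e.1 (G.r e.1) * !![-1, 0; 0, 1]).map (fun t : ℝ => (t : ℂ)))

/-- The permutation matrix which sends the coordinates `(u₁(end), u₂(end))`, grouped by edge ends,
to all first components followed by all second components. -/
def permC (G : MetricGraph V E) (v : V) : Matrix (G.End v ⊕ G.End v) (Fin 2 × G.End v) ℂ :=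
  fun i j => if i = (if j.1 = 0 then Sum.inl j.2 else Sum.inr j.2) then 1 else 0

/-- The transformed interface condition `β C (⨁ endMatrix) C*`. -/
def transformed (β : G.InterfaceConditions) (v : V) :
    Matrix (G.End v) (G.End v ⊕ G.End v) ℂ :=
  β.mat v * permC G v * Matrix.blockDiagonal (F.endMatrix v) * (permC G v)ᴴ

end FundamentalSystem

end MetricGraph

/-- The relation `U R U*`, for a unitary map `U` and a relation `R`. -/
def conjRelation {X Y : Type*} [NormedAddCommGroup X] [InnerProductSpace ℂ X]
    [NormedAddCommGroup Y] [InnerProductSpace ℂ Y] (U : X ≃ₗᵢ[ℂ] Y) (R : Submodule ℂ (X × X)) :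
    Submodule ℂ (Y × Y) :=
  R.map (LinearMap.prodMap (U.toLinearEquiv : X →ₗ[ℂ] Y) (U.toLinearEquiv : X →ₗ[ℂ] Y))

/-! ### Absolutely continuous functions -/

namespace AbsolutelyContinuousOnInterval

/-! The theorem is variation of constants at spectral parameter zero. If `-y'' + V y = g` and `(y',
y) = T h`, then the Wronskian identity `det T = 1` gives `h' = (-q g, p g)`. The Hamiltonian has
rank one, `H = (p, q)ᵗ (p, q)`, so that `H w` and `w* H w` depend on `w` only through the second
component `p w₁ + q w₂` of `T w`, called `row₂`: `H w = (p, q)ᵗ row₂ w` and `w* H w = |row₂ w|²`.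
Hence `J h' = -H k` holds for every `k` with `row₂ k = g` (`hasDerivAt_lift`), and conversely `J h'
= -H k` makes `row₂ h` a solution with right-hand side `row₂ k` (`solves_row₂`).

The same identity makes `w ↦ row₂ w` an isometry of `L²_H` onto `L²`, with inverse `f ↦ T⁻¹ (0, f)`;
this inverse is `U` on an edge. The first entry is invisible in `L²_H`: `T⁻¹ (0, f)` and `T⁻¹ (f',
f)` are the same element, and the latter is the absolutely continuous representative that the
relation asks for.

At a vertex, the boundary vector of `(y', y)` is `M` times that of `h`, where `M` is assembled from
the matrices `T` and `N T N` (`boundary_row`). Thus `β` for `(y', y)` becomes `β M` for `h`. Real `2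
× 2` blocks of determinant one give `M J M* = J`; so `β M` is again `J`-neutral of full rank, and an
invertible left factor, which does not change the kernel, makes its rows orthonormal.

It remains that `H` is a canonical system, which is delicate only on leads. If `p² + q²` were
integrable there, then `h' = z (-q y, p y)`, with `y = row₂ h`, would force `h` to be bounded for
every solution of `-y'' + V y = z y` and every `z`; all solutions would be square integrable,
against the limit point assumption. Existence of `p`, `q` for merely integrable `V` is a contraction
argument. -/

theorem comp_lipschitzOnWith {X Y : Type*} [PseudoMetricSpace X] [PseudoMetricSpace Y]
    {f : ℝ → X} {g : X → Y} {a b : ℝ} {s : Set X} {K : NNReal} (hg : LipschitzOnWith K g s)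
    (hf : AbsolutelyContinuousOnInterval f a b) (hs : MapsTo f (uIcc a b) s) :
    AbsolutelyContinuousOnInterval (fun x => g (f x)) a b := by
  rw [absolutelyContinuousOnInterval_iff] at hf ⊢
  intro ε hε
  -- `K + 1` in place of `K`, since the Lipschitz constant may be zero.
  obtain ⟨δ, hδ, h⟩ := hf (ε / (K + 1)) (by positivity)
  refine ⟨δ, hδ, fun I hI hlt => ?_⟩
  calc ∑ i ∈ Finset.range I.1, dist (g (f (I.2 i).1)) (g (f (I.2 i).2))
      ≤ ∑ i ∈ Finset.range I.1, K * dist (f (I.2 i).1) (f (I.2 i).2) :=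
        Finset.sum_le_sum fun i hi =>
          hg.dist_le_mul _ (hs (hI.1 i hi).1) _ (hs (hI.1 i hi).2)
    _ = K * ∑ i ∈ Finset.range I.1, dist (f (I.2 i).1) (f (I.2 i).2) := by
        rw [Finset.mul_sum]
    _ ≤ (K + 1) * ∑ i ∈ Finset.range I.1, dist (f (I.2 i).1) (f (I.2 i).2) := by
        gcongr
        simp
    _ < (K + 1) * (ε / (K + 1)) := by
        gcongr
        exact h I hI hlt
    _ = ε := by field_simp

theorem clm_comp {F F' : Type*} [NormedAddCommGroup F] [NormedSpace ℝ F]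
    [NormedAddCommGroup F'] [NormedSpace ℝ F'] (L : F →L[ℝ] F') {f : ℝ → F} {a b : ℝ}
    (hf : AbsolutelyContinuousOnInterval f a b) :
    AbsolutelyContinuousOnInterval (fun x => L (f x)) a b :=
  comp_lipschitzOnWith (L.lipschitz.lipschitzOnWith (s := univ)) hf (mapsTo_univ _ _)

theorem ofReal {f : ℝ → ℝ} {a b : ℝ} (hf : AbsolutelyContinuousOnInterval f a b) :
    AbsolutelyContinuousOnInterval (fun x => (f x : ℂ)) a b :=
  hf.clm_comp Complex.ofRealCLM

theorem apply {f : ℝ → Fin 2 → ℂ} {a b : ℝ} (hf : AbsolutelyContinuousOnInterval f a b)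
    (i : Fin 2) : AbsolutelyContinuousOnInterval (fun x => f x i) a b :=
  hf.clm_comp (ContinuousLinearMap.proj (R := ℝ) (φ := fun _ : Fin 2 => ℂ) i)

theorem congr {X : Type*} [PseudoMetricSpace X] {f g : ℝ → X} {a b : ℝ}
    (hf : AbsolutelyContinuousOnInterval f a b) (h : EqOn f g (uIcc a b)) :
    AbsolutelyContinuousOnInterval g a b := by
  rw [absolutelyContinuousOnInterval_iff] at hf ⊢
  intro ε hε
  obtain ⟨δ, hδ, H⟩ := hf ε hε
  refine ⟨δ, hδ, fun I hI hlt => ?_⟩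
  convert H I hI hlt using 2 with i hi
  rw [h (hI.1 i hi).1, h (hI.1 i hi).2]

theorem vec {f g : ℝ → ℂ} {a b : ℝ} (hf : AbsolutelyContinuousOnInterval f a b)
    (hg : AbsolutelyContinuousOnInterval g a b) :
    AbsolutelyContinuousOnInterval (fun x => ![f x, g x]) a b := by
  have h := (hf.clm_comp (ContinuousLinearMap.single ℝ (fun _ : Fin 2 => ℂ) 0)).add
    (hg.clm_comp (ContinuousLinearMap.single ℝ (fun _ : Fin 2 => ℂ) 1))
  refine h.congr fun x _ => ?_
  funext i
  fin_cases i <;> simp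

theorem complex_mul {f g : ℝ → ℂ} {a b : ℝ} (hf : AbsolutelyContinuousOnInterval f a b)
    (hg : AbsolutelyContinuousOnInterval g a b) :
    AbsolutelyContinuousOnInterval (fun x => f x * g x) a b :=
  hf.smul hg

/-- The exponential is Lipschitz only on bounded sets, which suffices because `f` is bounded on the
interval. -/
theorem exp {f : ℝ → ℝ} {a b : ℝ} (hf : AbsolutelyContinuousOnInterval f a b) :
    AbsolutelyContinuousOnInterval (fun x => Real.exp (f x)) a b := by
  obtain ⟨C, hC⟩ := hf.exists_bound
  obtain ⟨K, hK⟩ := Real.contDiff_exp.contDiffOn.exists_lipschitzOnWith (n := 1) (by decide)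
    (convex_closedBall (0 : ℝ) C) (isCompact_closedBall 0 C)
  exact comp_lipschitzOnWith hK hf fun x hx => by simpa using hC x hx

/-- An absolutely continuous function whose derivative is almost everywhere a given continuous
function is differentiable everywhere. -/
theorem hasDerivAt_of_ae {F : Type*} [NormedAddCommGroup F] [NormedSpace ℝ F] [CompleteSpace F]
    {f f' : ℝ → F} {a b : ℝ} (hf : AbsolutelyContinuousOnInterval f a b)
    (hf' : ContinuousOn f' (Icc a b)) (h : ∀ᵐ x, x ∈ uIcc a b → HasDerivAt f (f' x) x)
    {x : ℝ} (hx : x ∈ Ioo a b) : HasDerivAt f (f' x) x := by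
  have hab : a ≤ b := (hx.1.trans hx.2).le
  -- Extending `f'` by constants gives a function continuous on all of `ℝ`, whose primitive is `C¹`.
  -- The difference of `f` and this primitive has derivative zero almost everywhere, hence is
  -- constant.
  set φ : ℝ → F := IccExtend hab ((Icc a b).domRestrict f') with hφ
  have hφc : Continuous φ := hf'.domRestrict.Icc_extend'
  have hφf : ∀ t ∈ Icc a b, φ t = f' t := fun t ht => by
    rw [hφ, IccExtend_of_mem _ _ ht, domRestrict_apply]
  have hd : ∀ x, HasDerivAt (fun x => ∫ t in a..x, φ t) (φ x) x := fun x =>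
    intervalIntegral.integral_hasDerivAt_right (hφc.intervalIntegrable _ _)
      (hφc.stronglyMeasurableAtFilter _ _) hφc.continuousAt
  have hac : AbsolutelyContinuousOnInterval (fun x => ∫ t in a..x, φ t) a b := by
    refine ContDiffOn.absolutelyContinuousOnInterval (ContDiff.contDiffOn ?_)
    refine contDiff_one_iff_deriv.2 ⟨fun x => (hd x).differentiableAt, ?_⟩
    rwa [show deriv (fun x => ∫ t in a..x, φ t) = φ from funext fun x => (hd x).deriv]
  obtain ⟨C, hC⟩ := (hf.sub hac).const_of_ae_hasDerivAt_zero (by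
    filter_upwards [h] with x hx hxab
    have := (hx hxab).sub (hd x)
    rw [uIcc_of_le hab] at hxab
    rwa [hφf x hxab, sub_self] at this)
  rw [← hφf x (Ioo_subset_Icc_self hx)]
  refine ((hd x).add_const C).congr_of_eventuallyEq ?_
  filter_upwards [Icc_mem_nhds hx.1 hx.2] with t ht
  rw [← uIcc_of_le hab] at ht
  rw [← hC t ht]
  simp

/-- A bound for the increment of a vector-valued absolutely continuous function. -/
theorem norm_sub_le_integral {F : Type*} [NormedAddCommGroup F] [NormedSpace ℝ F]
    {f : ℝ → F} {h : ℝ → ℝ} {a b : ℝ} (hab : a ≤ b) (hf : AbsolutelyContinuousOnInterval f a b)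
    (hh : IntervalIntegrable h volume a b)
    (hd : ∀ᵐ x, x ∈ Ioo a b → ∃ d, HasDerivAt f d x ∧ ‖d‖ ≤ h x) :
    ‖f b - f a‖ ≤ ∫ t in a..b, h t := by
  -- A norming functional reduces the bound to the fundamental theorem of calculus for the scalar
  -- function `L ∘ f`.
  obtain ⟨L, hL, hLx⟩ := exists_dual_vector'' ℝ (f b - f a)
  have hac := hf.clm_comp L
  have h1 := hac.integral_deriv_eq_sub
  rw [← map_sub, hLx] at h1
  refine (le_of_eq h1.symm).trans ?_
  refine intervalIntegral.integral_mono_ae_restrict hab hac.intervalIntegrable_deriv hh ?_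
  refine (ae_restrict_iff' measurableSet_Icc).2 ?_
  filter_upwards [hd, Measure.ae_ne volume a, Measure.ae_ne volume b] with x hx hxa hxb hxI
  obtain ⟨d, hd, hdh⟩ := hx ⟨lt_of_le_of_ne hxI.1 hxa.symm, lt_of_le_of_ne hxI.2 hxb⟩
  have h2 : HasDerivAt (fun x => L (f x)) (L d) x := L.hasFDerivAt.comp_hasDerivAt x hd
  rw [h2.deriv]
  calc L d ≤ ‖L d‖ := le_abs_self _
    _ ≤ ‖L‖ * ‖d‖ := L.le_opNorm d
    _ ≤ 1 * ‖d‖ := by gcongr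
    _ ≤ h x := by rwa [one_mul]

end AbsolutelyContinuousOnInterval

/-! ### Linear differential equations with integrable coefficients -/

theorem intervalIntegrable_clm_apply {X : Type*} [NormedAddCommGroup X] [NormedSpace ℝ X]
    {A : ℝ → X →L[ℝ] X} {b c : ℝ} (hA : IntervalIntegrable A volume b c) {u : ℝ → X}
    (hu : Continuous u) : IntervalIntegrable (fun t => A t (u t)) volume b c := by
  obtain ⟨C, hC⟩ := isCompact_uIcc.exists_bound_of_continuousOn (hu.continuousOn (s := uIcc b c))
  refine (hA.norm.mul_const C).mono_fun ?_ ?_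
  · exact (ContinuousLinearMap.apply ℝ X).flip.aestronglyMeasurable_comp₂
      (intervalIntegrable_iff.1 hA).aestronglyMeasurable hu.aestronglyMeasurable
  · refine (ae_restrict_iff' measurableSet_uIoc).2 (Filter.Eventually.of_forall fun t ht => ?_)
    refine ((A t).le_opNorm _).trans (le_trans ?_ (le_abs_self _))
    exact mul_le_mul_of_nonneg_left (hC t (uIoc_subset_uIcc ht)) (norm_nonneg _)

/-- The integrand is almost everywhere the derivative of `exp (2 ∫ h) / 2`, and the contribution
`-1/2` of the left endpoint is dropped. The factor 2 in the exponent is the source of the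
contraction constant `1/2` below. -/
theorem integral_mul_exp_primitive_le {h : ℝ → ℝ} {a b : ℝ}
    (hh : IntervalIntegrable h volume a b) :
    ∫ t in a..b, h t * Real.exp (2 * ∫ s in a..t, h s) ≤
      Real.exp (2 * ∫ s in a..b, h s) / 2 := by
  have hac := hh.absolutelyContinuousOnInterval_intervalIntegral (c := a) left_mem_uIcc
  have h1 := ((hac.const_mul 2).exp.const_mul (1 / 2)).integral_deriv_eq_sub
  have h2 : ∫ t in a..b, h t * Real.exp (2 * ∫ s in a..t, h s) =
      ∫ t in a..b, deriv (fun x => 1 / 2 * Real.exp (2 * ∫ s in a..x, h s)) t := by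
    refine intervalIntegral.integral_congr_ae ?_
    filter_upwards [hh.ae_hasDerivAt_integral] with t ht htab
    have h3 := ((((ht (uIoc_subset_uIcc htab) a left_mem_uIcc).const_mul 2).exp).const_mul (1 / 2))
    rw [h3.deriv]
    ring
  rw [h2, h1]
  simp only [intervalIntegral.integral_same, mul_zero, Real.exp_zero]
  linarith

/-- Solutions of `u' = A u`, `u(a) = u₀`, in integral form. -/
theorem exists_solution_linear_integral_equation {X : Type*} [NormedAddCommGroup X]
    [NormedSpace ℝ X] [CompleteSpace X] {A : ℝ → X →L[ℝ] X}
    (hA : ∀ b c, IntervalIntegrable A volume b c) (a : ℝ) (u₀ : X) :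
    ∃ u : ℝ → X, Continuous u ∧ ∀ x, a ≤ x → u x = u₀ + ∫ t in a..x, A t (u t) := by
  -- The weight `exp (2 g)` makes the Picard map a contraction on the whole half-line at once, even
  -- if `g` is unbounded.
  set g : ℝ → ℝ := fun x => ∫ t in a..x, ‖A t‖ with hg
  have hgc : Continuous g := intervalIntegral.continuous_primitive (fun b c => (hA b c).norm) a
  have hg0 : ∀ x, a ≤ x → 0 ≤ g x := fun x hx =>
    intervalIntegral.integral_nonneg hx fun t _ => norm_nonneg _
  have hint : ∀ u : ℝ → X, Continuous u → ∀ b c,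
      IntervalIntegrable (fun t => A t (u t)) volume b c := fun u hu b c =>
    intervalIntegrable_clm_apply (hA b c) hu
  have hbound : ∀ (u : ℝ → X) (C : ℝ), (∀ t, ‖u t‖ ≤ C * Real.exp (2 * g t)) → 0 ≤ C →
      ∀ x, a ≤ x → ‖∫ t in a..x, A t (u t)‖ ≤ C * Real.exp (2 * g x) / 2 := by
    intro u C hC hC0 x hx
    have h1 : ‖∫ t in a..x, A t (u t)‖ ≤ ∫ t in a..x, C * (‖A t‖ * Real.exp (2 * g t)) := by
      refine intervalIntegral.norm_integral_le_of_norm_le hx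
        (Filter.Eventually.of_forall fun t _ => ?_) ?_
      · refine ((A t).le_opNorm _).trans ?_
        calc ‖A t‖ * ‖u t‖ ≤ ‖A t‖ * (C * Real.exp (2 * g t)) := by gcongr; exact hC t
          _ = _ := by ring
      · exact ((hA a x).norm.mul_continuousOn (by fun_prop)).const_mul C
    refine h1.trans ?_
    rw [intervalIntegral.integral_const_mul, mul_div_assoc]
    gcongr
    exact integral_mul_exp_primitive_le (hA a x).norm
  -- The Picard map in the unknown `v = exp (-2 g) u`. With `max x a` the functions live on `ℝ`, and
  -- are constant to the left of `a`.
  set Ψ : (ℝ → X) → ℝ → X := fun v x =>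
    Real.exp (-(2 * g (max x a))) •
      (u₀ + ∫ t in a..max x a, A t (Real.exp (2 * g t) • v t)) with hΨ
  have hwc : ∀ v : BoundedContinuousFunction ℝ X,
      Continuous fun t => Real.exp (2 * g t) • v t := fun v => by fun_prop
  have hΨc : ∀ v : BoundedContinuousFunction ℝ X, Continuous (Ψ v) := by
    intro v
    have h1 : Continuous fun x => ∫ t in a..x, A t (Real.exp (2 * g t) • v t) :=
      intervalIntegral.continuous_primitive (hint _ (hwc v)) a
    have h2 : Continuous fun x : ℝ => max x a := by fun_prop
    exact (Real.continuous_exp.comp ((hgc.comp h2).const_mul 2).neg).smul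
      (continuous_const.add (h1.comp h2))
  have hest : ∀ (v : ℝ → X) (C : ℝ), (∀ t, ‖v t‖ ≤ C) → ∀ x,
      ‖Real.exp (-(2 * g (max x a))) • ∫ t in a..max x a, A t (Real.exp (2 * g t) • v t)‖
        ≤ C / 2 := by
    intro v C hC x
    have h1 := hbound (fun t => Real.exp (2 * g t) • v t) C (fun t => by
      rw [norm_smul, Real.norm_of_nonneg (Real.exp_pos _).le, mul_comm]
      gcongr
      exact hC t) ((norm_nonneg _).trans (hC a)) (max x a) (le_max_right _ _)
    rw [norm_smul, Real.norm_of_nonneg (Real.exp_pos _).le]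
    calc _ ≤ Real.exp (-(2 * g (max x a))) * (C * Real.exp (2 * g (max x a)) / 2) := by gcongr
      _ = C / 2 * (Real.exp (-(2 * g (max x a))) * Real.exp (2 * g (max x a))) := by ring
      _ = C / 2 := by rw [← Real.exp_add]; simp
  have hΨb : ∀ (v : BoundedContinuousFunction ℝ X) x, ‖Ψ v x‖ ≤ ‖u₀‖ + ‖v‖ / 2 := by
    intro v x
    rw [hΨ]
    simp only [smul_add]
    refine (norm_add_le _ _).trans (add_le_add ?_ (hest v ‖v‖ v.norm_coe_le_norm x))
    rw [norm_smul, Real.norm_of_nonneg (Real.exp_pos _).le]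
    refine mul_le_of_le_one_left (norm_nonneg _) (Real.exp_le_one_iff.2 ?_)
    linarith [hg0 (max x a) (le_max_right _ _)]
  set Φ : BoundedContinuousFunction ℝ X → BoundedContinuousFunction ℝ X := fun v =>
    BoundedContinuousFunction.ofNormedAddCommGroup (Ψ v) (hΨc v) _ (hΨb v) with hΦ
  have hcontr : ContractingWith (1 / 2) Φ := by
    refine ⟨by norm_num, LipschitzWith.of_dist_le_mul fun v w => ?_⟩
    rw [BoundedContinuousFunction.dist_le (by positivity)]
    intro x
    have h1 : Φ v x - Φ w x = Real.exp (-(2 * g (max x a))) •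
        ∫ t in a..max x a, A t (Real.exp (2 * g t) • (v - w) t) := by
      simp only [hΦ, BoundedContinuousFunction.coe_ofNormedAddCommGroup, hΨ]
      rw [← smul_sub, add_sub_add_left_eq_sub,
        ← intervalIntegral.integral_sub (hint _ (hwc v) _ _) (hint _ (hwc w) _ _)]
      simp [smul_sub]
    rw [dist_eq_norm, h1, dist_eq_norm]
    refine (hest (v - w) ‖v - w‖ (v - w).norm_coe_le_norm x).trans (le_of_eq ?_)
    simp
    ring
  obtain ⟨v, hvΦ⟩ : ∃ v, Φ v = v := ⟨_, hcontr.fixedPoint_isFixedPt⟩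
  have hv : ∀ x, v x = Ψ v x := fun x => (DFunLike.congr_fun hvΦ x).symm
  refine ⟨fun x => Real.exp (2 * g x) • v x, hwc v, fun x hx => ?_⟩
  simp only
  rw [hv x, hΨ]
  simp only [max_eq_left hx, smul_smul, ← Real.exp_add]
  simp

/-! ### Edges, and existence of the fundamental system -/

namespace MetricGraph

variable {V E : Type*} {G : MetricGraph V E} {e : E}

theorem left_mem_closedEdge : -G.r e ∈ G.closedEdge e :=
  ⟨le_rfl, fun _ => by linarith [G.r_pos e]⟩

theorem right_mem_closedEdge (_ : G.tgt e ≠ none) : G.r e ∈ G.closedEdge e :=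
  ⟨by linarith [G.r_pos e], fun _ => le_rfl⟩

theorem edge_subset_closedEdge : G.edge e ⊆ G.closedEdge e :=
  fun _ hx => ⟨hx.1.le, fun h => (hx.2 h).le⟩

theorem Ioo_subset_edge {c : ℝ} (hc : c ∈ G.closedEdge e) : Ioo (-G.r e) c ⊆ G.edge e :=
  fun _ hx => ⟨hx.1, fun h => hx.2.trans_le (hc.2 h)⟩

theorem measurableSet_edge : MeasurableSet (G.edge e) := (G.isOpen_edge e).measurableSet

/-- Treats compact edges and leads alike: a part of the edge bounded on the right lies in an
interval on which integrability and absolute continuity up to the vertices apply. -/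
theorem exists_edge_inter_subset (G : MetricGraph V E) (e : E) (c : ℝ) :
    ∃ c' ∈ G.closedEdge e, G.edge e ∩ Iic c ⊆ Ioo (-G.r e) c' := by
  by_cases h : G.tgt e = none
  · refine ⟨max c (-G.r e) + 1, ⟨by linarith [le_max_right c (-G.r e)], fun h' => absurd h h'⟩,
      fun x hx => ⟨hx.1.1, ?_⟩⟩
    have : x ≤ c := hx.2
    linarith [le_max_left c (-G.r e)]
  · exact ⟨G.r e, right_mem_closedEdge h, fun x hx => ⟨hx.1.1, hx.1.2 h⟩⟩

theorem exists_mem_Ioo_of_mem_edge {x : ℝ} (hx : x ∈ G.edge e) :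
    ∃ c ∈ G.closedEdge e, x ∈ Ioo (-G.r e) c := by
  obtain ⟨c, hc, h⟩ := G.exists_edge_inter_subset e x
  exact ⟨c, hc, h ⟨hx, self_mem_Iic⟩⟩

theorem ae_uIcc_of_ae_edge {p : ℝ → Prop} (h : ∀ᵐ x ∂(volume.restrict (G.edge e)), p x) {c : ℝ}
    (hc : c ∈ G.closedEdge e) : ∀ᵐ x, x ∈ uIcc (-G.r e) c → p x := by
  filter_upwards [(ae_restrict_iff' measurableSet_edge).1 h, Measure.ae_ne volume (-G.r e),
    Measure.ae_ne volume c] with x hx hxa hxc hxI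
  rw [uIcc_of_le hc.1] at hxI
  exact hx (Ioo_subset_edge hc ⟨lt_of_le_of_ne hxI.1 hxa.symm, lt_of_le_of_ne hxI.2 hxc⟩)

theorem AC.continuousOn_edge {F : Type*} [SeminormedAddCommGroup F] {f : ℝ → F} (hf : G.AC e f) :
    ContinuousOn f (G.edge e) := by
  intro x hx
  obtain ⟨c, hc, hxc⟩ := exists_mem_Ioo_of_mem_edge hx
  have h := (hf c hc).continuousOn
  rw [uIcc_of_le hc.1] at h
  exact (h.continuousAt (Icc_mem_nhds hxc.1 hxc.2)).continuousWithinAt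

theorem AC.aestronglyMeasurable {F : Type*} [NormedAddCommGroup F] {f : ℝ → F} (hf : G.AC e f) :
    AEStronglyMeasurable f (volume.restrict (G.edge e)) :=
  ContinuousOn.aestronglyMeasurable hf.continuousOn_edge measurableSet_edge

theorem intervalIntegrable_indicator_edge {W : ℝ → ℝ} (hW : G.IntegrableUpToVertices e W)
    (b c : ℝ) : IntervalIntegrable ((G.edge e).indicator W) volume b c := by
  rw [intervalIntegrable_iff, IntegrableOn, integrable_indicator_iff measurableSet_edge,
    IntegrableOn, Measure.restrict_restrict measurableSet_edge]
  obtain ⟨c', hc', h⟩ := G.exists_edge_inter_subset e (max b c)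
  refine (hW c' hc').mono_set (Subset.trans ?_ h)
  gcongr
  exact fun x hx => hx.2

/-- The equation is the first-order system `u' = (A₀ + w A₁) u` for `u = (y, y')`. The potential is
cut off outside the edge, so that the coefficient is integrable on every bounded interval. -/
theorem exists_solves_zero {W : ℝ → ℝ} (hW : G.IntegrableUpToVertices e W) (y₀ y₁ : ℝ) :
    ∃ y y' : ℝ → ℝ, G.Solves e W y y' 0 ∧ y (-G.r e) = y₀ ∧ y' (-G.r e) = y₁ := by
  set a := -G.r e
  set w := (G.edge e).indicator W with hw
  have hwi : ∀ b c, IntervalIntegrable w volume b c := intervalIntegrable_indicator_edge hW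
  set A₀ : ℝ × ℝ →L[ℝ] ℝ × ℝ :=
    (ContinuousLinearMap.inl ℝ ℝ ℝ).comp (ContinuousLinearMap.snd ℝ ℝ ℝ)
  set A₁ : ℝ × ℝ →L[ℝ] ℝ × ℝ :=
    (ContinuousLinearMap.inr ℝ ℝ ℝ).comp (ContinuousLinearMap.fst ℝ ℝ ℝ)
  obtain ⟨u, huc, hu⟩ := exists_solution_linear_integral_equation
    (A := fun t => A₀ + w t • A₁)
    (fun b c => intervalIntegrable_const.add ((hwi b c).smul_continuousOn continuousOn_const))
    a (y₀, y₁)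
  have hi : ∀ b c, IntervalIntegrable (fun t => (A₀ + w t • A₁) (u t)) volume b c := fun b c =>
    intervalIntegrable_clm_apply
      (intervalIntegrable_const.add ((hwi b c).smul_continuousOn continuousOn_const)) huc
  have hu1 : ∀ x, a ≤ x → (u x).1 = y₀ + ∫ t in a..x, (u t).2 := by
    intro x hx
    rw [hu x hx, Prod.fst_add]
    congr 1
    have := (ContinuousLinearMap.fst ℝ ℝ ℝ).intervalIntegral_comp_comm (hi a x)
    simpa [A₀, A₁] using this.symm
  have hu2 : ∀ x, a ≤ x → (u x).2 = y₁ + ∫ t in a..x, w t * (u t).1 := by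
    intro x hx
    rw [hu x hx, Prod.snd_add]
    congr 1
    have := (ContinuousLinearMap.snd ℝ ℝ ℝ).intervalIntegral_comp_comm (hi a x)
    simpa [A₀, A₁] using this.symm
  have hu2c : Continuous fun t => (u t).2 := by fun_prop
  have hwu : ∀ b c, IntervalIntegrable (fun t => w t * (u t).1) volume b c := fun b c =>
    (hwi b c).mul_continuousOn (by fun_prop)
  -- The solution is given by the integrals, not by the components of `u`: the integral equation is
  -- known only for `x ≥ a`, whereas derivatives and primitives are handled on all of `ℝ`.
  refine ⟨fun x => y₀ + ∫ t in a..x, (u t).2, fun x => y₁ + ∫ t in a..x, w t * (u t).1,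
    ⟨fun c hc => ?_, fun c hc => ?_, fun x hx => ?_, ?_⟩, by simp, by simp⟩
  · exact (ContDiffOn.absolutelyContinuousOnInterval contDiffOn_const).add
      ((hu2c.intervalIntegrable _ _).absolutelyContinuousOnInterval_intervalIntegral left_mem_uIcc)
  · exact (ContDiffOn.absolutelyContinuousOnInterval contDiffOn_const).add
      ((hwu _ _).absolutelyContinuousOnInterval_intervalIntegral left_mem_uIcc)
  · rw [← hu2 x hx.1.le]
    exact (intervalIntegral.integral_hasDerivAt_right (hu2c.intervalIntegrable _ _)
      (hu2c.stronglyMeasurableAtFilter _ _) hu2c.continuousAt).const_add y₀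
  · have hloc : LocallyIntegrable (fun t => w t * (u t).1) volume := fun x =>
      ⟨Icc (x - 1) (x + 1), Icc_mem_nhds (by linarith) (by linarith),
        (intervalIntegrable_iff_integrableOn_Icc_of_le (by linarith)).1 (hwu _ _)⟩
    filter_upwards [ae_restrict_of_ae (LocallyIntegrable.ae_hasDerivAt_integral hloc), G.ae_mem_edge e] with x hx hxe
    refine ⟨_, (hx a).const_add y₁, ?_⟩
    rw [← hu1 x hxe.1.le, hw, indicator_of_mem hxe]
    simp

theorem FundamentalSystem.nonempty (P : G.Potential) : Nonempty (FundamentalSystem P) := by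
  choose p p' hp hp0 hp1 using fun e => exists_solves_zero (P.integrable e) 0 1
  choose q q' hq hq0 hq1 using fun e => exists_solves_zero (P.integrable e) 1 0
  exact ⟨⟨p, p', q, q', hp, hq, hp1, hp0, hq1, hq0⟩⟩

end MetricGraph

/-! ### The transfer matrix -/

namespace MetricGraph

variable {V E : Type*} {G : MetricGraph V E} {e : E}

namespace FundamentalSystem

variable {P : G.Potential} (F : FundamentalSystem P)

/-- The terms with `V` cancel in the derivative, and the value at `-r` is 1. Absolute continuity
carries the identity to the vertices, where the interface conditions need it. -/
theorem wronskian {x : ℝ} (hx : x ∈ G.closedEdge e) :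
    F.p' e x * F.q e x - F.q' e x * F.p e x = 1 := by
  have hac := (((F.solves_p e).ac' x hx).mul ((F.solves_q e).ac x hx)).sub
    (((F.solves_q e).ac' x hx).mul ((F.solves_p e).ac x hx))
  obtain ⟨C, hC⟩ := hac.const_of_ae_hasDerivAt_zero (by
    refine ae_uIcc_of_ae_edge ?_ hx
    filter_upwards [(F.solves_p e).eqn, (F.solves_q e).eqn, G.ae_mem_edge e]
      with t ⟨d, hd, h1⟩ ⟨d', hd', h2⟩ hte
    convert (hd.mul ((F.solves_q e).hasDerivAt t hte)).sub
      (hd'.mul ((F.solves_p e).hasDerivAt t hte)) using 1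
    simp only [smul_eq_mul, Pi.zero_apply] at h1 h2
    linear_combination F.q e t * h1 - F.p e t * h2)
  have h1 := hC x right_mem_uIcc
  have h2 := hC (-G.r e) left_mem_uIcc
  simp only [Pi.sub_apply, Pi.mul_apply, F.p'_init, F.p_init, F.q_init, F.q'_init] at h1 h2
  linarith

theorem wronskian_complex {x : ℝ} (hx : x ∈ G.closedEdge e) :
    (F.p' e x : ℂ) * F.q e x - F.q' e x * F.p e x = 1 := by
  exact_mod_cast congrArg (fun t : ℝ => (t : ℂ)) (F.wronskian hx)

theorem det_T {x : ℝ} (hx : x ∈ G.closedEdge e) : (F.T e x).det = 1 := by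
  rw [T, Matrix.det_fin_two_of]
  exact F.wronskian hx

theorem inv_T {x : ℝ} (hx : x ∈ G.closedEdge e) :
    (F.T e x)⁻¹ = !![F.q e x, -F.q' e x; -F.p e x, F.p' e x] := by
  rw [Matrix.inv_def, F.det_T hx, T, Matrix.adjugate_fin_two_of]
  simp

/-- The Hamiltonian whose entries are the products of the solutions `p` and `q`. -/
noncomputable def hamiltonian (e : E) : Hamiltonian (G.edge e) where
  toFun x := !![F.p e x ^ 2, F.p e x * F.q e x; F.p e x * F.q e x, F.q e x ^ 2]
  posSemidef := Filter.Eventually.of_forall fun x => by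
    have h := Matrix.posSemidef_vecMulVec_self_star ![F.p e x, F.q e x]
    convert h using 1
    ext i j
    fin_cases i <;> fin_cases j <;> simp [Matrix.vecMulVec_apply] <;> ring
  locallyIntegrable a b := by
    have hp : ContinuousOn (F.p e) (G.edge e) := AC.continuousOn_edge (F.solves_p e).ac
    have hq : ContinuousOn (F.q e) (G.edge e) := AC.continuousOn_edge (F.solves_q e).ac
    refine ContinuousOn.locallyIntegrableOn ?_ measurableSet_edge
    fin_cases a <;> fin_cases b <;>
      simp only [Fin.zero_eta, Fin.mk_one, Matrix.of_apply, Matrix.cons_val_zero,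
        Matrix.cons_val_one, Matrix.cons_val', Matrix.cons_val_fin_one] <;> fun_prop

/-- The first component `p' w₁ + q' w₂` of `T w`. -/
def row₁ (e : E) (w : ℝ → Fin 2 → ℂ) (x : ℝ) : ℂ := F.p' e x * w x 0 + F.q' e x * w x 1

/-- The second component `p w₁ + q w₂` of `T w`. -/
def row₂ (e : E) (w : ℝ → Fin 2 → ℂ) (x : ℝ) : ℂ := F.p e x * w x 0 + F.q e x * w x 1

/-- The vector `T⁻¹ (a, b)`. -/
def lift (e : E) (a b : ℝ → ℂ) (x : ℝ) : Fin 2 → ℂ :=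
  ![F.q e x * a x - F.q' e x * b x, F.p' e x * b x - F.p e x * a x]

theorem row₁_lift (a b : ℝ → ℂ) {x : ℝ} (hx : x ∈ G.closedEdge e) :
    F.row₁ e (F.lift e a b) x = a x := by
  simp only [row₁, lift, Matrix.cons_val_zero, Matrix.cons_val_one]
  linear_combination a x * F.wronskian_complex hx

theorem row₂_lift (a b : ℝ → ℂ) {x : ℝ} (hx : x ∈ G.closedEdge e) :
    F.row₂ e (F.lift e a b) x = b x := by
  simp only [row₂, lift, Matrix.cons_val_zero, Matrix.cons_val_one]
  linear_combination b x * F.wronskian_complex hx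

theorem lift_zero_eq_inv_mulVec (b : ℝ → ℂ) {x : ℝ} (hx : x ∈ G.closedEdge e) :
    F.lift e 0 b x = ((F.T e x)⁻¹.map (fun t : ℝ => (t : ℂ))) *ᵥ ![0, b x] := by
  rw [F.inv_T hx]
  funext i
  fin_cases i <;> simp [lift, Matrix.mulVec, dotProduct, Fin.sum_univ_two]

/-- The rank-one structure `H = (p, q)ᵗ (p, q)`. -/
theorem cplx_mulVec (w : ℝ → Fin 2 → ℂ) (x : ℝ) :
    (F.hamiltonian e).cplx x *ᵥ w x = ![F.p e x * F.row₂ e w x, F.q e x * F.row₂ e w x] := by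
  funext i
  fin_cases i <;>
    simp [Hamiltonian.cplx, hamiltonian, row₂, Matrix.mulVec, dotProduct, Fin.sum_univ_two] <;>
    ring

theorem form_eq (v w : ℝ → Fin 2 → ℂ) (x : ℝ) :
    (F.hamiltonian e).form v w x = conj (F.row₂ e v x) * F.row₂ e w x := by
  rw [Hamiltonian.form, cplx_mulVec]
  simp only [dotProduct, Fin.sum_univ_two, Pi.star_apply, RCLike.star_def, Matrix.cons_val_zero,
    Matrix.cons_val_one]
  simp only [row₂, map_add, map_mul, Complex.conj_ofReal]
  ring

theorem form_self_eq (w : ℝ → Fin 2 → ℂ) (x : ℝ) :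
    (F.hamiltonian e).form w w x = ((‖F.row₂ e w x‖ ^ 2 : ℝ) : ℂ) := by
  rw [form_eq, Complex.conj_mul', Complex.ofReal_pow]

theorem ac_lift {a b : ℝ → ℂ} (ha : G.AC e a) (hb : G.AC e b) : G.AC e (F.lift e a b) :=
  fun c hc => AbsolutelyContinuousOnInterval.vec
    ((((F.solves_q e).ac c hc).ofReal.complex_mul (ha c hc)).sub
      (((F.solves_q e).ac' c hc).ofReal.complex_mul (hb c hc)))
    ((((F.solves_p e).ac' c hc).ofReal.complex_mul (hb c hc)).sub
      (((F.solves_p e).ac c hc).ofReal.complex_mul (ha c hc)))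

theorem ac_row₁ {w : ℝ → Fin 2 → ℂ} (hw : G.AC e w) : G.AC e (F.row₁ e w) :=
  fun c hc => (((F.solves_p e).ac' c hc).ofReal.complex_mul ((hw c hc).apply 0)).add
    (((F.solves_q e).ac' c hc).ofReal.complex_mul ((hw c hc).apply 1))

theorem ac_row₂ {w : ℝ → Fin 2 → ℂ} (hw : G.AC e w) : G.AC e (F.row₂ e w) :=
  fun c hc => (((F.solves_p e).ac c hc).ofReal.complex_mul ((hw c hc).apply 0)).add
    (((F.solves_q e).ac c hc).ofReal.complex_mul ((hw c hc).apply 1))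

/-- If `-y'' + V y = g`, then `h = T⁻¹ (y', y)` satisfies `h' = (-q g, p g)`. -/
theorem hasDerivAt_lift {y y' g : ℝ → ℂ} (hs : G.Solves e (P.fn e) y y' g) :
    ∀ᵐ x ∂(volume.restrict (G.edge e)),
      HasDerivAt (F.lift e y' y) ![-(F.q e x * g x), F.p e x * g x] x := by
  filter_upwards [hs.eqn, (F.solves_p e).eqn, (F.solves_q e).eqn, G.ae_mem_edge e]
    with x ⟨d, hd, h⟩ ⟨dp, hdp, hp⟩ ⟨dq, hdq, hq⟩ hx
  simp only [smul_eq_mul, Pi.zero_apply, Complex.real_smul] at h hp hq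
  have hp' : -(dp : ℂ) + P.fn e x * F.p e x = 0 := by exact_mod_cast congrArg Complex.ofReal hp
  have hq' : -(dq : ℂ) + P.fn e x * F.q e x = 0 := by exact_mod_cast congrArg Complex.ofReal hq
  have hy := hs.hasDerivAt x hx
  have h0p := ((F.solves_p e).hasDerivAt x hx).ofReal_comp
  have h0q := ((F.solves_q e).hasDerivAt x hx).ofReal_comp
  rw [hasDerivAt_pi]
  intro i
  fin_cases i
  -- The products `q' y'` cancel, and so do the two terms `V q y`; only `-q g` survives.
  · have := (h0q.mul hd).sub (hdq.ofReal_comp.mul hy)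
    refine this.congr_deriv ?_
    simp only [Fin.zero_eta, Matrix.cons_val_zero]
    linear_combination -(F.q e x : ℂ) * h + y x * hq'
  · have := (hdp.ofReal_comp.mul hy).sub (h0p.mul hd)
    refine this.congr_deriv ?_
    simp only [Fin.mk_one, Matrix.cons_val_one, Matrix.cons_val_fin_one]
    linear_combination (F.p e x : ℂ) * h - y x * hp'

/-- If `J h' = -H k`, then `T h = (y', y)` where `-y'' + V y = p k₁ + q k₂`. -/
theorem solves_row₂ {h k : ℝ → Fin 2 → ℂ} (hac : G.AC e h)
    (hd : ∀ᵐ x ∂(volume.restrict (G.edge e)), ∃ d, HasDerivAt h d x ∧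
      !![0, -1; 1, 0] *ᵥ d = -((F.hamiltonian e).cplx x *ᵥ k x)) :
    G.Solves e (P.fn e) (F.row₂ e h) (F.row₁ e h) (F.row₂ e k) := by
  have hd' : ∀ᵐ x ∂(volume.restrict (G.edge e)),
      HasDerivAt (fun t => h t 0) (-(F.q e x * F.row₂ e k x)) x ∧
      HasDerivAt (fun t => h t 1) (F.p e x * F.row₂ e k x) x := by
    filter_upwards [hd] with x ⟨d, hd, hJ⟩
    rw [hasDerivAt_pi] at hd
    rw [cplx_mulVec] at hJ
    have h0 := congrFun hJ 0
    have h1 := congrFun hJ 1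
    simp [Matrix.mulVec, dotProduct, Fin.sum_univ_two] at h0 h1
    rw [← h0, ← h1]
    exact ⟨hd 0, hd 1⟩
  have hy' := F.ac_row₁ hac
  have hy := F.ac_row₂ hac
  -- The contributions of `h'` cancel here, as `p (-q g) + q (p g) = 0`.
  have hder : ∀ᵐ x ∂(volume.restrict (G.edge e)), HasDerivAt (F.row₂ e h) (F.row₁ e h x) x := by
    filter_upwards [hd', G.ae_mem_edge e] with x ⟨h0, h1⟩ hx
    have := (((F.solves_p e).hasDerivAt x hx).ofReal_comp.mul h0).add
      (((F.solves_q e).hasDerivAt x hx).ofReal_comp.mul h1)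
    refine this.congr_deriv ?_
    simp only [row₁]
    ring
  refine ⟨hy, hy', fun x hx => ?_, ?_⟩
  · obtain ⟨c, hc, hxc⟩ := exists_mem_Ioo_of_mem_edge hx
    have hcont := (hy' c hc).continuousOn
    rw [uIcc_of_le hc.1] at hcont
    -- `Solves` asks for the derivative of `y` at every point; continuity of `row₁ h` provides it.
    exact AbsolutelyContinuousOnInterval.hasDerivAt_of_ae (hy c hc) hcont (ae_uIcc_of_ae_edge hder hc) hxc
  · filter_upwards [hd', (F.solves_p e).eqn, (F.solves_q e).eqn, G.ae_mem_edge e]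
      with x ⟨h0, h1⟩ ⟨dp, hdp, hp⟩ ⟨dq, hdq, hq⟩ hx
    simp only [smul_eq_mul, Pi.zero_apply] at hp hq
    have hp' : -(dp : ℂ) + P.fn e x * F.p e x = 0 := by exact_mod_cast congrArg Complex.ofReal hp
    have hq' : -(dq : ℂ) + P.fn e x * F.q e x = 0 := by exact_mod_cast congrArg Complex.ofReal hq
    refine ⟨_, (hdp.ofReal_comp.mul h0).add (hdq.ofReal_comp.mul h1), ?_⟩
    have hw := F.wronskian_complex (edge_subset_closedEdge hx)
    simp only [Complex.real_smul]
    have : F.row₂ e h x = F.p e x * h x 0 + F.q e x * h x 1 := rfl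
    rw [this]
    -- In `y''` the derivative of `h` contributes `p' (-q g) + q' (p g)`, which is `-g` by the
    -- Wronskian.
    linear_combination h x 0 * hp' + h x 1 * hq' + F.row₂ e k x * hw

end FundamentalSystem

end MetricGraph

/-! ### The canonical system -/

/-- An absolutely continuous function with `‖h'‖ ≤ κ ‖h‖` and integrable `κ` is bounded. -/
theorem exists_bound_of_norm_deriv_le {F : Type*} [NormedAddCommGroup F] [NormedSpace ℝ F]
    {h : ℝ → F} {κ : ℝ → ℝ} {a : ℝ} (hκ : IntegrableOn κ (Ioi a)) (hκ0 : ∀ x, 0 ≤ κ x)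
    (hac : ∀ c, a ≤ c → AbsolutelyContinuousOnInterval h a c)
    (hd : ∀ᵐ x, x ∈ Ioi a → ∃ d, HasDerivAt h d x ∧ ‖d‖ ≤ κ x * ‖h x‖) :
    ∃ B, ∀ x, a ≤ x → ‖h x‖ ≤ B := by
  have hlim := intervalIntegral_tendsto_integral_Ioi a hκ Filter.tendsto_id
  have hi : ∀ b c, a ≤ b → b ≤ c → IntervalIntegrable κ volume b c := fun b c hb hc =>
    (intervalIntegrable_iff_integrableOn_Ioc_of_le hc).2
      (hκ.mono_set fun x hx => hb.trans_lt hx.1)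
  -- Beyond `c` the integral of `κ` is at most `1/2`.
  obtain ⟨c, hc, hac'⟩ : ∃ c, (∫ x in Ioi a, κ x) - 1 / 2 < ∫ x in a..c, κ x ∧ a ≤ c :=
    ((hlim.eventually (lt_mem_nhds (by simp))).and (Filter.eventually_ge_atTop a)).exists
  have hsmall : ∀ t, c ≤ t → ∫ x in c..t, κ x ≤ 1 / 2 := by
    intro t ht
    have h1 : (∫ x in a..c, κ x) + ∫ x in c..t, κ x = ∫ x in a..t, κ x :=
      intervalIntegral.integral_add_adjacent_intervals (hi _ _ le_rfl hac') (hi _ _ hac' ht)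
    have h2 : ∫ x in a..t, κ x ≤ ∫ x in Ioi a, κ x := by
      rw [intervalIntegral.integral_of_le (hac'.trans ht)]
      exact setIntegral_mono_set hκ (Filter.Eventually.of_forall hκ0)
        (Filter.Eventually.of_forall fun x hx => hx.1)
    linarith
  obtain ⟨B, hB⟩ := (hac c hac').exists_bound
  refine ⟨2 * B, fun X hX => ?_⟩
  have hB0 : 0 ≤ B := (norm_nonneg _).trans (hB c right_mem_uIcc)
  rcases le_total X c with hXc | hXc
  · have := hB X (by rw [uIcc_of_le hac']; exact ⟨hX, hXc⟩)
    linarith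
  have hcont := (hac X hX).continuousOn
  rw [uIcc_of_le hX] at hcont
  -- At a maximum point `t` of `‖h‖` on `[c, X]` one gets `‖h t‖ ≤ ‖h c‖ + ‖h t‖ / 2`, hence the
  -- bound `2 B`, which does not depend on `X`.
  obtain ⟨t, ht, hmax⟩ := isCompact_Icc.exists_isMaxOn (nonempty_Icc.2 hXc)
    ((hcont.mono (Icc_subset_Icc_left hac')).norm)
  have hmax' : ∀ s ∈ Icc c X, ‖h s‖ ≤ ‖h t‖ := fun s hs => hmax hs
  have hinc : ‖h t - h c‖ ≤ ∫ s in c..t, κ s * ‖h t‖ := by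
    refine AbsolutelyContinuousOnInterval.norm_sub_le_integral ht.1 ((hac X hX).mono ?_)
      ((hi c t hac' ht.1).mul_const _) ?_
    · rw [uIcc_of_le ht.1, uIcc_of_le hX]
      exact Icc_subset_Icc hac' ht.2
    · filter_upwards [hd] with s hs hsI
      obtain ⟨d, hd, hle⟩ := hs (hac'.trans_lt hsI.1)
      refine ⟨d, hd, hle.trans ?_⟩
      exact mul_le_mul_of_nonneg_left (hmax' s ⟨hsI.1.le, hsI.2.le.trans ht.2⟩) (hκ0 s)
  rw [intervalIntegral.integral_mul_const] at hinc
  have h1 : (∫ s in c..t, κ s) * ‖h t‖ ≤ 1 / 2 * ‖h t‖ :=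
    mul_le_mul_of_nonneg_right (hsmall t ht.1) (norm_nonneg _)
  have h2 := norm_le_norm_add_norm_sub' (h t) (h c)
  have h3 := hB c right_mem_uIcc
  have h4 := hmax' X ⟨hXc, le_rfl⟩
  linarith

namespace MetricGraph

variable {V E : Type*} {G : MetricGraph V E} {e : E}

namespace FundamentalSystem

variable {P : G.Potential} (F : FundamentalSystem P)

theorem norm_row₂_le (w : ℝ → Fin 2 → ℂ) (x : ℝ) :
    ‖F.row₂ e w x‖ ≤ |F.p e x| * ‖w x‖ + |F.q e x| * ‖w x‖ := by
  have h0 := norm_le_pi_norm (w x) 0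
  have h1 := norm_le_pi_norm (w x) 1
  refine (norm_add_le _ _).trans ?_
  rw [norm_mul, norm_mul, Complex.norm_real, Complex.norm_real, Real.norm_eq_abs,
    Real.norm_eq_abs]
  gcongr

theorem norm_sq_row₂_le (w : ℝ → Fin 2 → ℂ) (x : ℝ) :
    ‖F.row₂ e w x‖ ^ 2 ≤ 2 * (F.p e x ^ 2 + F.q e x ^ 2) * ‖w x‖ ^ 2 := by
  have h := F.norm_row₂_le (e := e) w x
  calc ‖F.row₂ e w x‖ ^ 2 ≤ (|F.p e x| * ‖w x‖ + |F.q e x| * ‖w x‖) ^ 2 := by gcongr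
    _ = (|F.p e x| + |F.q e x|) ^ 2 * ‖w x‖ ^ 2 := by ring
    _ ≤ 2 * (F.p e x ^ 2 + F.q e x ^ 2) * ‖w x‖ ^ 2 := by
      gcongr
      rw [← sq_abs (F.p e x), ← sq_abs (F.q e x)]
      exact add_sq_le

theorem norm_vec_row₂_le (w : ℝ → Fin 2 → ℂ) (x : ℝ) :
    ‖![-(F.q e x * F.row₂ e w x), F.p e x * F.row₂ e w x]‖ ≤
      2 * (F.p e x ^ 2 + F.q e x ^ 2) * ‖w x‖ := by
  have h := F.norm_row₂_le (e := e) w x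
  have hp := abs_nonneg (F.p e x)
  have hq := abs_nonneg (F.q e x)
  have hb : (|F.p e x| + |F.q e x|) ^ 2 ≤ 2 * (F.p e x ^ 2 + F.q e x ^ 2) := by
    rw [← sq_abs (F.p e x), ← sq_abs (F.q e x)]
    exact add_sq_le
  refine (pi_norm_le_iff_of_nonneg (by positivity)).2 fun i => ?_
  have key : ∀ s, 0 ≤ s → s ≤ |F.p e x| + |F.q e x| →
      s * ‖F.row₂ e w x‖ ≤ 2 * (F.p e x ^ 2 + F.q e x ^ 2) * ‖w x‖ := by
    intro s hs0 hs
    calc s * ‖F.row₂ e w x‖ ≤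
        (|F.p e x| + |F.q e x|) * (|F.p e x| * ‖w x‖ + |F.q e x| * ‖w x‖) := by gcongr
      _ = (|F.p e x| + |F.q e x|) ^ 2 * ‖w x‖ := by ring
      _ ≤ _ := by gcongr
  fin_cases i
  · simpa using key |F.q e x| hq (by linarith)
  · simpa using key |F.p e x| hp (by linarith)

/-- In the limit point case, `p` and `q` are not both square integrable. -/
theorem not_integrable_of_limitPoint (he : G.tgt e = none) (hlp : G.LimitPoint e (P.fn e)) :
    ¬ IntegrableOn (fun x => F.p e x ^ 2 + F.q e x ^ 2) (G.edge e) := by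
  intro hint
  obtain ⟨z, y, y', hs, hy⟩ := hlp
  have hedge : G.edge e = Ioi (-G.r e) := by
    ext x
    simp [edge, he]
  have hclosed : ∀ c, -G.r e ≤ c → c ∈ G.closedEdge e := fun c hc => ⟨hc, fun h => absurd he h⟩
  set h := F.lift e y' y with hh
  have hac : G.AC e h := F.ac_lift hs.ac' hs.ac
  obtain ⟨B, hB⟩ := exists_bound_of_norm_deriv_le (h := h) (a := -G.r e)
    (κ := fun x => ‖z‖ * (2 * (F.p e x ^ 2 + F.q e x ^ 2)))
    (by rw [← hedge]; exact (hint.const_mul 2).const_mul _) (fun x => by positivity)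
    (fun c hc => hac c (hclosed c hc)) (by
      have := F.hasDerivAt_lift hs
      rw [ae_restrict_iff' measurableSet_edge, hedge] at this
      filter_upwards [this] with x hx hxe
      refine ⟨_, hx hxe, ?_⟩
      -- Since `y = row₂ h`, the formula for `h'` is a homogeneous linear equation in `h`, with
      -- coefficient of size `‖z‖ (p² + q²)`.
      have h1 : ![-(F.q e x * (z • y) x), F.p e x * (z • y) x] =
          z • ![-(F.q e x * F.row₂ e h x), F.p e x * F.row₂ e h x] := by
        rw [hh, F.row₂_lift _ _ (hclosed x (le_of_lt hxe))]
        funext i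
        fin_cases i <;> simp <;> ring
      rw [h1, norm_smul, mul_assoc]
      gcongr
      exact F.norm_vec_row₂_le h x)
  refine hy ((memLp_two_iff_integrable_sq_norm (AC.aestronglyMeasurable hs.ac)).2 ?_)
  refine ((hint.const_mul 2).mul_const (B ^ 2)).mono'
    ((AC.aestronglyMeasurable hs.ac).norm.pow 2) ?_
  filter_upwards [G.ae_mem_edge e] with x hx
  have hxc := edge_subset_closedEdge hx
  have h1 := F.norm_sq_row₂_le (e := e) h x
  rw [hh, F.row₂_lift _ _ hxc, ← hh] at h1
  rw [Real.norm_of_nonneg (by positivity)]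
  refine h1.trans ?_
  gcongr
  exact hB x hxc.1

/-- The canonical system with the Hamiltonians `F.hamiltonian`. -/
noncomputable def canonicalSystem : G.CanonicalSystem where
  H := F.hamiltonian
  regular e a b c hc := by
    have hp := ((F.solves_p e).ac c hc).continuousOn
    have hq := ((F.solves_q e).ac c hc).continuousOn
    rw [uIcc_of_le hc.1] at hp hq
    refine (ContinuousOn.integrableOn_Icc ?_).mono_set Ioo_subset_Icc_self
    fin_cases a <;> fin_cases b <;>
      simp only [hamiltonian, Fin.zero_eta, Fin.mk_one, Matrix.of_apply, Matrix.cons_val_zero,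
        Matrix.cons_val_one, Matrix.cons_val', Matrix.cons_val_fin_one] <;> fun_prop
  not_integrable e he h := by
    refine F.not_integrable_of_limitPoint he (P.limitPoint e he) ?_
    have h0 := h 0 0
    have h1 := h 1 1
    simp only [hamiltonian, Matrix.of_apply, Matrix.cons_val_zero, Matrix.cons_val_one,
      Matrix.cons_val', Matrix.cons_val_fin_one] at h0 h1
    -- The trace of `H` is `p² + q²`.
    exact h0.add h1

end FundamentalSystem

end MetricGraph

/-! ### The unitary map -/

namespace MetricGraph

variable {V E : Type*} {G : MetricGraph V E} {e : E}

namespace FundamentalSystem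

variable {P : G.Potential} (F : FundamentalSystem P)

theorem aestronglyMeasurable_ofReal {f : ℝ → ℝ} (hf : G.AC e f) :
    AEStronglyMeasurable (fun x => (f x : ℂ)) (volume.restrict (G.edge e)) :=
  AC.aestronglyMeasurable fun c hc => (hf c hc).ofReal

theorem aestronglyMeasurable_row₂ {w : ℝ → Fin 2 → ℂ}
    (hw : AEStronglyMeasurable w (volume.restrict (G.edge e))) :
    AEStronglyMeasurable (F.row₂ e w) (volume.restrict (G.edge e)) :=
  ((aestronglyMeasurable_ofReal (F.solves_p e).ac).mul
    ((continuous_apply (0 : Fin 2)).comp_aestronglyMeasurable hw)).add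
  ((aestronglyMeasurable_ofReal (F.solves_q e).ac).mul
    ((continuous_apply (1 : Fin 2)).comp_aestronglyMeasurable hw))

theorem aestronglyMeasurable_lift {a b : ℝ → ℂ}
    (ha : AEStronglyMeasurable a (volume.restrict (G.edge e)))
    (hb : AEStronglyMeasurable b (volume.restrict (G.edge e))) :
    AEStronglyMeasurable (F.lift e a b) (volume.restrict (G.edge e)) := by
  have h0 := ((aestronglyMeasurable_ofReal (F.solves_q e).ac).mul ha).sub
    ((aestronglyMeasurable_ofReal (F.solves_q e).ac').mul hb)
  have h1 := ((aestronglyMeasurable_ofReal (F.solves_p e).ac').mul hb).sub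
    ((aestronglyMeasurable_ofReal (F.solves_p e).ac).mul ha)
  have hc : Continuous fun z : ℂ × ℂ => ![z.1, z.2] := by
    refine continuous_pi fun i => ?_
    fin_cases i <;> simp <;> fun_prop
  exact hc.comp_aestronglyMeasurable (h0.prodMk h1)

theorem mem_preSubmodule_iff {w : ℝ → Fin 2 → ℂ}
    (hw : AEStronglyMeasurable w (volume.restrict (G.edge e))) :
    w ∈ (F.hamiltonian e).preSubmodule ↔ MemLp (F.row₂ e w) 2 (volume.restrict (G.edge e)) := by
  rw [memLp_two_iff_integrable_sq_norm (F.aestronglyMeasurable_row₂ hw)]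
  have h : (F.hamiltonian e).form w w = fun x => ((‖F.row₂ e w x‖ ^ 2 : ℝ) : ℂ) :=
    funext fun x => F.form_self_eq w x
  refine ⟨fun H => ?_, fun H => ⟨hw, ?_⟩⟩
  · have := H.2
    rw [h] at this
    exact this.re
  · rw [h]
    exact H.ofReal

theorem memLp_row₂ (w : (F.hamiltonian e).PreL2) :
    MemLp (F.row₂ e w.fn) 2 (volume.restrict (G.edge e)) :=
  (F.mem_preSubmodule_iff w.2.1).1 w.2

/-- The map `w ↦ p w₁ + q w₂` on the space of representatives. -/
noncomputable def preUnitary (e : E) :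
    (F.hamiltonian e).PreL2 →ₗᵢ[ℂ] Lp ℂ 2 (volume.restrict (G.edge e)) where
  toFun w := (F.memLp_row₂ w).toLp
  map_add' v w := by
    rw [← MemLp.toLp_add]
    congr 1
    funext x
    change F.p e x * (v.fn x 0 + w.fn x 0) + F.q e x * (v.fn x 1 + w.fn x 1) =
      (F.p e x * v.fn x 0 + F.q e x * v.fn x 1) + (F.p e x * w.fn x 0 + F.q e x * w.fn x 1)
    ring
  map_smul' c w := by
    rw [RingHom.id_apply, ← MemLp.toLp_const_smul]
    congr 1
    funext x
    change F.p e x * (c * w.fn x 0) + F.q e x * (c * w.fn x 1) =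
      c * (F.p e x * w.fn x 0 + F.q e x * w.fn x 1)
    ring
  norm_map' w := by
    rw [← sq_eq_sq₀ (norm_nonneg _) (norm_nonneg _), @norm_sq_eq_re_inner ℂ,
      @norm_sq_eq_re_inner ℂ _ _ _ _ w]
    congr 1
    rw [L2.inner_def]
    change _ = ∫ x in G.edge e, (F.hamiltonian e).form w.fn w.fn x
    refine integral_congr_ae ?_
    filter_upwards [(F.memLp_row₂ w).coeFn_toLp] with x hx
    simp only [LinearMap.coe_mk, AddHom.coe_mk]
    rw [hx, form_eq, RCLike.inner_apply']

theorem preUnitary_coeFn (w : (F.hamiltonian e).PreL2) :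
    F.preUnitary e w =ᵐ[volume.restrict (G.edge e)] F.row₂ e w.fn :=
  (F.memLp_row₂ w).coeFn_toLp

theorem lift_mem {a b : ℝ → ℂ} (ha : AEStronglyMeasurable a (volume.restrict (G.edge e)))
    (hb : MemLp b 2 (volume.restrict (G.edge e))) :
    F.lift e a b ∈ (F.hamiltonian e).preSubmodule := by
  rw [F.mem_preSubmodule_iff (F.aestronglyMeasurable_lift ha hb.1)]
  refine hb.ae_eq ?_
  filter_upwards [G.ae_mem_edge e] with x hx
  exact (F.row₂_lift _ _ (edge_subset_closedEdge hx)).symm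

/-- The element of `L²_H` represented by `T⁻¹ (a, b)`. -/
noncomputable def liftPre {a b : ℝ → ℂ}
    (ha : AEStronglyMeasurable a (volume.restrict (G.edge e)))
    (hb : MemLp b 2 (volume.restrict (G.edge e))) : (F.hamiltonian e).PreL2 :=
  ⟨F.lift e a b, F.lift_mem ha hb⟩

/-- The result does not involve `a`: as `preUnitary` is isometric, `T⁻¹ (a, b)` has the same class
for every `a`. Both `a = 0` and `a = y'` are used. -/
theorem preUnitary_liftPre {a b : ℝ → ℂ}
    (ha : AEStronglyMeasurable a (volume.restrict (G.edge e)))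
    (hb : MemLp b 2 (volume.restrict (G.edge e))) :
    F.preUnitary e (F.liftPre ha hb) =ᵐ[volume.restrict (G.edge e)] b := by
  filter_upwards [F.preUnitary_coeFn (F.liftPre ha hb), G.ae_mem_edge e] with x h hx
  rw [h]
  exact F.row₂_lift _ _ (edge_subset_closedEdge hx)

/-- The unitary map `L²_H → L²` which sends `w` to `p w₁ + q w₂`. -/
noncomputable def edgeUnitary (e : E) :
    (F.hamiltonian e).L2 ≃ₗᵢ[ℂ] Lp ℂ 2 (volume.restrict (G.edge e)) :=
  LinearIsometryEquiv.ofSurjective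
    -- Inseparable representatives have inseparable images, and these are equal in `Lp`.
    { toLinearMap := (SeparationQuotient.liftCLM (F.preUnitary e).toContinuousLinearMap
        (fun x y h => (h.map (F.preUnitary e).continuous).eq)).toLinearMap
      norm_map' := fun w => by
        obtain ⟨w, rfl⟩ := SeparationQuotient.surjective_mk w
        exact (F.preUnitary e).norm_map w }
    (fun f => ⟨Hamiltonian.cls (F.liftPre (a := 0) aestronglyMeasurable_zero (Lp.memLp f)),
      Lp.ext (F.preUnitary_liftPre aestronglyMeasurable_zero (Lp.memLp f))⟩)

theorem edgeUnitary_cls (w : (F.hamiltonian e).PreL2) :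
    F.edgeUnitary e (Hamiltonian.cls w) = F.preUnitary e w := rfl

theorem edgeUnitary_symm_apply (f : Lp ℂ 2 (volume.restrict (G.edge e))) :
    (F.edgeUnitary e).symm f =
      Hamiltonian.cls (F.liftPre (a := 0) aestronglyMeasurable_zero (Lp.memLp f)) := by
  rw [LinearIsometryEquiv.symm_apply_eq, edgeUnitary_cls]
  exact (Lp.ext (F.preUnitary_liftPre aestronglyMeasurable_zero (Lp.memLp f))).symm

end FundamentalSystem

end MetricGraph

/-! ### The interface conditions -/

/-- Every matrix `A` with a right inverse has a multiple `B A`, `B` invertible, with orthonormal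
rows. -/
theorem Matrix.exists_isUnit_mul_orthonormal {m n : Type*} [Fintype m] [DecidableEq m] [Fintype n]
    {A : Matrix m n ℂ} {R : Matrix n m ℂ} (hR : A * R = 1) :
    ∃ B : Matrix m m ℂ, IsUnit B ∧ (B * A) * (B * A)ᴴ = 1 := by
  have hinj : Function.Injective fun v => v ᵥ* A := fun v w h => by
    have := congrArg (fun u => u ᵥ* R) h
    simpa [Matrix.vecMul_vecMul, hR] using this
  open scoped ComplexOrder in
  have hpos : (A * Aᴴ).PosDef := Matrix.PosDef.mul_conjTranspose_self A hinj
  open scoped ComplexOrder in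
  have hunit : IsUnit (A * Aᴴ).det := (Matrix.isUnit_iff_isUnit_det _).1 hpos.isUnit
  obtain ⟨B, hB⟩ : ∃ B : Matrix m m ℂ, (A * Aᴴ)⁻¹ = Bᴴ * B := by
    open scoped MatrixOrder ComplexOrder in
    exact CStarAlgebra.nonneg_iff_eq_star_mul_self.mp hpos.inv.posSemidef.nonneg
  -- For square matrices the factors may be exchanged, and `B (A A* Bᴴ) = 1` says both that `B` is
  -- invertible and that the rows of `B A` are orthonormal.
  have h1 : (A * Aᴴ * Bᴴ) * B = 1 := by
    rw [Matrix.mul_assoc, ← hB, Matrix.mul_nonsing_inv _ hunit]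
  have h2 : B * (A * Aᴴ * Bᴴ) = 1 := mul_eq_one_comm.1 h1
  refine ⟨B, IsUnit.of_mul_eq_one _ h2, ?_⟩
  rw [Matrix.conjTranspose_mul, ← h2]
  simp only [Matrix.mul_assoc]

namespace MetricGraph

variable {V E : Type*} {G : MetricGraph V E}

namespace FundamentalSystem

variable {P : G.Potential} (F : FundamentalSystem P)

/-- Conjugation by `N` does not change the determinant. -/
theorem det_endMatrix (v : V) (i : G.End v) :
    F.endMatrix v i 0 0 * F.endMatrix v i 1 1 - F.endMatrix v i 0 1 * F.endMatrix v i 1 0 = 1 := by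
  rcases i with ⟨e, he⟩ | ⟨e, he⟩
  · have := F.wronskian_complex (left_mem_closedEdge (G := G) (e := e))
    simpa [endMatrix, T] using this
  · have := F.wronskian_complex (right_mem_closedEdge (G := G) (e := e) (by simp [he]))
    simpa [endMatrix, T, Matrix.mul_apply, Fin.sum_univ_two] using this

theorem conj_endMatrix (v : V) (i : G.End v) (a b : Fin 2) :
    conj (F.endMatrix v i a b) = F.endMatrix v i a b := by
  rcases i with i | i <;> simp [endMatrix]

theorem boundary_congr {a b a' b' : E → ℝ → ℂ} (v : V)
    (ha : ∀ e, ∀ x ∈ G.closedEdge e, a e x = a' e x)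
    (hb : ∀ e, ∀ x ∈ G.closedEdge e, b e x = b' e x) :
    G.boundary v a b = G.boundary v a' b' := by
  have hr : ∀ i : {e : E // G.tgt e = some v}, G.r i.1 ∈ G.closedEdge i.1 := fun i =>
    right_mem_closedEdge (by simp [i.2])
  funext i
  rcases i with (i | i) | (i | i)
  · exact ha _ _ left_mem_closedEdge
  · exact congrArg Neg.neg (ha _ _ (hr i))
  · exact hb _ _ left_mem_closedEdge
  · exact hb _ _ (hr i)

variable [DecidableEq V] [Fintype E] [DecidableEq E]

/-- The matrix `C (⨁ endMatrix) C*` in block form. -/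
noncomputable def blockMatrix (v : V) : Matrix (G.End v ⊕ G.End v) (G.End v ⊕ G.End v) ℂ :=
  Matrix.fromBlocks (Matrix.diagonal fun i => F.endMatrix v i 0 0)
    (Matrix.diagonal fun i => F.endMatrix v i 0 1) (Matrix.diagonal fun i => F.endMatrix v i 1 0)
    (Matrix.diagonal fun i => F.endMatrix v i 1 1)

theorem permC_mul_blockDiagonal_mul (v : V) :
    permC G v * Matrix.blockDiagonal (F.endMatrix v) * (permC G v)ᴴ = F.blockMatrix v := by
  ext i j
  have h1 : ∀ i j, (permC G v * Matrix.blockDiagonal (F.endMatrix v)) i j =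
      Sum.elim (fun k => if k = j.2 then F.endMatrix v k 0 j.1 else 0)
        (fun k => if k = j.2 then F.endMatrix v k 1 j.1 else 0) i := by
    intro i j
    rcases i with i | i <;>
      simp only [Matrix.mul_apply, permC, Fintype.sum_prod_type, Matrix.blockDiagonal_apply,
        Fin.sum_univ_two] <;>
      by_cases h : i = j.2 <;> simp [h, -Fintype.sum_sum_type]
  rw [Matrix.mul_apply]
  simp only [h1, Matrix.conjTranspose_apply]
  rcases i with i | i <;> rcases j with j | j <;>
    simp [permC, Fintype.sum_prod_type, blockMatrix, Matrix.diagonal_apply, Fin.sum_univ_two,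
      -Fintype.sum_sum_type]

theorem transformed_eq (β : G.InterfaceConditions) (v : V) :
    F.transformed β v = β.mat v * F.blockMatrix v := by
  rw [transformed, ← permC_mul_blockDiagonal_mul]
  simp only [Matrix.mul_assoc]

/-- All blocks are diagonal, so this is the identity `A J Aᵗ = (det A) J` for `2 × 2` matrices at
each edge end; as the entries are real, the adjoint is the transpose. -/
theorem blockMatrix_mul_J_mul (v : V) :
    F.blockMatrix v * Matrix.J (G.End v) ℂ * (F.blockMatrix v)ᴴ = Matrix.J (G.End v) ℂ := by
  have h := F.det_endMatrix v
  simp only [blockMatrix, Matrix.J, Matrix.fromBlocks_conjTranspose, Matrix.fromBlocks_multiply,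
    Matrix.diagonal_conjTranspose, Matrix.mul_zero, Matrix.mul_one, Matrix.mul_neg, zero_add,
    add_zero, Matrix.diagonal_mul_diagonal, Matrix.diagonal_neg,
    Matrix.diagonal_add, Pi.star_apply, RCLike.star_def, conj_endMatrix]
  congr 1 <;> ext i j <;> by_cases hij : i = j
  all_goals
    simp only [hij, Matrix.diagonal_apply, Matrix.zero_apply, Matrix.neg_apply, Matrix.one_apply,
      if_true, if_false, neg_zero]
  · ring
  · linear_combination -h j
  · linear_combination h j
  · ring

/-- From `M J M* = J` and `J² = -1`. -/
theorem exists_right_inverse_blockMatrix (v : V) :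
    ∃ R, F.blockMatrix v * R = 1 := by
  refine ⟨Matrix.J (G.End v) ℂ * (F.blockMatrix v)ᴴ * (-Matrix.J (G.End v) ℂ), ?_⟩
  rw [← Matrix.mul_assoc, ← Matrix.mul_assoc, blockMatrix_mul_J_mul, Matrix.mul_neg,
    Matrix.J_squared, neg_neg]

/-- `β M` has the right inverse `M⁻¹ β*`, so its rows can be made orthonormal by an invertible left
factor, which preserves both the kernel and `J`-neutrality. -/
theorem exists_interfaceConditions (β : G.InterfaceConditions) :
    ∃ α : G.InterfaceConditions,
      ∀ v w, α.mat v *ᵥ w = 0 ↔ F.transformed β v *ᵥ w = 0 := by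
  have hR : ∀ v, ∃ R : Matrix (G.End v ⊕ G.End v) (G.End v) ℂ, F.transformed β v * R = 1 := fun v => by
    obtain ⟨R, hR⟩ := F.exists_right_inverse_blockMatrix v
    refine ⟨R * (β.mat v)ᴴ, ?_⟩
    rw [transformed_eq, Matrix.mul_assoc (β.mat v), ← Matrix.mul_assoc _ R, hR, Matrix.one_mul,
      β.mul_conjTranspose]
  choose R hR using hR
  choose B hB hBA using fun v => Matrix.exists_isUnit_mul_orthonormal (hR v)
  refine ⟨⟨fun v => B v * F.transformed β v, hBA, fun v => ?_⟩, fun v w => ?_⟩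
  · have : B v * F.transformed β v * Matrix.J (G.End v) ℂ * (B v * F.transformed β v)ᴴ =
        B v * (β.mat v * (F.blockMatrix v * Matrix.J (G.End v) ℂ * (F.blockMatrix v)ᴴ) *
          (β.mat v)ᴴ) * (B v)ᴴ := by
      rw [transformed_eq]
      simp only [Matrix.conjTranspose_mul, Matrix.mul_assoc]
    rw [this, blockMatrix_mul_J_mul, β.mul_J_mul, Matrix.mul_zero, Matrix.zero_mul]
  · simp only [← Matrix.mulVec_mulVec]
    refine ⟨fun h => Matrix.mulVec_injective_of_isUnit (hB v) ?_, fun h => ?_⟩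
    · simpa using h
    · rw [h, Matrix.mulVec_zero]

/-- At an incoming end the boundary vector of `h` is `N h`, and `(N T N)(N h) = N (T h)`; this is
the reason for the conjugation by `N`. -/
theorem boundary_row (h : ∀ _ : E, ℝ → Fin 2 → ℂ) (v : V) :
    G.boundary v (fun e => F.row₁ e (h e)) (fun e => F.row₂ e (h e)) =
      F.blockMatrix v *ᵥ G.boundary v (fun e x => h e x 0) (fun e x => h e x 1) := by
  funext i
  rw [blockMatrix, Matrix.fromBlocks_mulVec]
  rcases i with (i | i) | (i | i) <;>
    simp [boundary, Matrix.mulVec_diagonal, endMatrix, row₁, row₂, T]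
  ring

end FundamentalSystem

end MetricGraph

/-! ### Unitary equivalence of the Schrödinger operator and the canonical system -/

namespace MetricGraph

variable {V E : Type*} {G : MetricGraph V E}

theorem Solves.congr {e : E} {W : ℝ → ℝ} {y y' g g' : ℝ → ℂ} (hs : G.Solves e W y y' g)
    (h : g =ᵐ[volume.restrict (G.edge e)] g') : G.Solves e W y y' g' := by
  refine ⟨hs.ac, hs.ac', hs.hasDerivAt, ?_⟩
  filter_upwards [hs.eqn, h] with x ⟨d, hd, heq⟩ hx
  exact ⟨d, hd, heq.trans hx⟩

namespace FundamentalSystem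

variable {P : G.Potential} (F : FundamentalSystem P) [DecidableEq V] [Fintype E] [DecidableEq E]

/-- The unitary map `(fₑ) ↦ (Tₑ⁻¹ (0, fₑ))`. -/
noncomputable def unitary : G.SpaceL2 ≃ₗᵢ[ℂ] F.canonicalSystem.Space :=
  LinearIsometryEquiv.piLpCongrRight 2 fun e => (F.edgeUnitary e).symm

theorem mem_schrodingerGraph_iff_mem_relation {β α : G.InterfaceConditions}
    (hα : ∀ v w, α.mat v *ᵥ w = 0 ↔ F.transformed β v *ᵥ w = 0) (f g : G.SpaceL2) :
    (f, g) ∈ schrodingerGraph P β ↔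
      (F.unitary f, F.unitary g) ∈ F.canonicalSystem.relation α := by
  constructor
  · rintro ⟨y, y', hf, hs, hb⟩
    have hy : ∀ e, MemLp (y e) 2 (volume.restrict (G.edge e)) := fun e =>
      (Lp.memLp (f e)).ae_eq (hf e)
    -- Only the first member of the pair needs an absolutely continuous representative, `T⁻¹ (y',
    -- y)`; for the second, `T⁻¹ (0, g)` will do.
    refine ⟨fun e => F.liftPre (AC.aestronglyMeasurable (hs e).ac') (hy e),
      fun e => F.liftPre (a := 0) aestronglyMeasurable_zero (Lp.memLp (g e)),
      fun e => ?_, fun e => F.edgeUnitary_symm_apply (g e),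
      fun e => F.ac_lift (hs e).ac' (hs e).ac, fun e => ?_, fun v => ?_⟩
    · refine (LinearIsometryEquiv.symm_apply_eq (F.edgeUnitary e)).2 (Lp.ext ?_)
      exact (hf e).trans (F.preUnitary_liftPre _ (hy e)).symm
    · filter_upwards [F.hasDerivAt_lift (hs e), G.ae_mem_edge e] with x hx hxe
      refine ⟨_, hx, ?_⟩
      change _ = -((F.hamiltonian e).cplx x *ᵥ F.lift e 0 (g e) x)
      rw [cplx_mulVec, F.row₂_lift _ _ (edge_subset_closedEdge hxe)]
      funext i
      fin_cases i <;> simp [Matrix.mulVec, dotProduct, Fin.sum_univ_two]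
    · rw [hα, transformed_eq, ← Matrix.mulVec_mulVec]
      have h := F.boundary_row (fun e => F.lift e (y' e) (y e)) v
      refine Eq.trans (congrArg _ (h.symm.trans ?_)) (hb v)
      exact boundary_congr v (fun e x hx => F.row₁_lift _ _ hx) (fun e x hx => F.row₂_lift _ _ hx)
  · rintro ⟨h, k, hf, hg, hac, hJ, hb⟩
    have hf' : ∀ e, f e =ᵐ[volume.restrict (G.edge e)] F.row₂ e (h e).fn := fun e => by
      have : f e = F.preUnitary e (h e) := (LinearIsometryEquiv.symm_apply_eq (F.edgeUnitary e)).1 (hf e)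
      rw [this]
      exact F.preUnitary_coeFn _
    have hg' : ∀ e, g e =ᵐ[volume.restrict (G.edge e)] F.row₂ e (k e).fn := fun e => by
      have : g e = F.preUnitary e (k e) := (LinearIsometryEquiv.symm_apply_eq (F.edgeUnitary e)).1 (hg e)
      rw [this]
      exact F.preUnitary_coeFn _
    refine ⟨fun e => F.row₂ e (h e).fn, fun e => F.row₁ e (h e).fn, hf',
      fun e => (F.solves_row₂ (hac e) (hJ e)).congr (hg' e).symm, fun v => ?_⟩
    have := hb v
    rw [hα, transformed_eq, ← Matrix.mulVec_mulVec] at this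
    rw [F.boundary_row (fun e => (h e).fn)]
    exact this

theorem conjRelation_schrodinger {β α : G.InterfaceConditions}
    (hα : ∀ v w, α.mat v *ᵥ w = 0 ↔ F.transformed β v *ᵥ w = 0) :
    conjRelation F.unitary (schrodinger P β).graph = F.canonicalSystem.relation α := by
  rw [schrodinger_graph]
  ext ⟨a, b⟩
  constructor
  · rintro ⟨⟨f, g⟩, hfg, h⟩
    rw [← h]
    exact (F.mem_schrodingerGraph_iff_mem_relation hα f g).1 hfg
  · intro h
    refine ⟨(F.unitary.symm a, F.unitary.symm b), ?_, ?_⟩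
    · refine (F.mem_schrodingerGraph_iff_mem_relation hα _ _).2 ?_
      rwa [LinearIsometryEquiv.apply_symm_apply, LinearIsometryEquiv.apply_symm_apply]
    · exact Prod.ext (F.unitary.apply_symm_apply a) (F.unitary.apply_symm_apply b)

end FundamentalSystem

end MetricGraph

theorem mainTheorem4 {V E : Type*} [Fintype V] [DecidableEq V] [Fintype E] [DecidableEq E]
    (G : MetricGraph V E) (P : G.Potential) (β : G.InterfaceConditions) :
    Nonempty (MetricGraph.FundamentalSystem P) ∧
    ∀ F : MetricGraph.FundamentalSystem P,
      (∀ e, ∀ x ∈ G.closedEdge e, (F.T e x).det = 1) ∧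
      (∃ α : G.InterfaceConditions,
        ∀ v w, α.mat v *ᵥ w = 0 ↔ F.transformed β v *ᵥ w = 0) ∧
      ∃ K : G.CanonicalSystem,
        (∀ e x, (K.H e).toFun x =
          !![F.p e x ^ 2, F.p e x * F.q e x; F.p e x * F.q e x, F.q e x ^ 2]) ∧
        ∃ U : G.SpaceL2 ≃ₗᵢ[ℂ] K.Space,
          (∀ (f : G.SpaceL2) (e : E), ∃ φ : (K.H e).PreL2, U f e = Hamiltonian.cls φ ∧
            ∀ᵐ x ∂(volume.restrict (G.edge e)),
              φ.fn x = ((F.T e x)⁻¹.map (fun t : ℝ => (t : ℂ))) *ᵥ ![0, f e x]) ∧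
          ∀ α : G.InterfaceConditions,
            (∀ v w, α.mat v *ᵥ w = 0 ↔ F.transformed β v *ᵥ w = 0) →
            conjRelation U (MetricGraph.schrodinger P β).graph = K.relation α := by

  refine ⟨MetricGraph.FundamentalSystem.nonempty P, fun F =>
    ⟨fun e x hx => F.det_T hx, F.exists_interfaceConditions β, F.canonicalSystem,
      fun e x => rfl, F.unitary, fun f e => ?_, fun α hα => F.conjRelation_schrodinger hα⟩⟩
  refine ⟨F.liftPre (a := 0) aestronglyMeasurable_zero (Lp.memLp (f e)),
    F.edgeUnitary_symm_apply (f e), ?_⟩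
  filter_upwards [G.ae_mem_edge e] with x hx
  exact F.lift_zero_eq_inv_mulVec _ (MetricGraph.edge_subset_closedEdge hx)
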